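/- Let $p$ be an odd prime, $K$ a finite extension of $\mathbb{Q}_p$ and $E/K$ a ramified quadratic extension; all fields lie in a fixed algebraic closure of $K$. Write $\mathcal{O}_F$ for the ring of integers of a field $F$ and $\pi_E$ for a uniformizer of $E$. For $s\ge 1$ let $K_s/K$ be the unramified extension of degree $s$ and $E_s=E\cdot K_s$. For $s=2r$ even let $\sigma$ be the Frobenius in $\mathrm{Gal}(E_s/E)$, $\tau$ the nontrivial element of $\mathrm{Gal}(E_s/K_s)$, $\eta=\tau\sigma^r$, $L\subset E_s$ the fixed field of $\eta$, and $\pi_L$ a uniformizer of $L$ with $\mathrm{Tr}_{L/K_r}\pi_L=0$. For $s=1$ let $\eta$ be the nontrivial element of $\mathrm{Gal}(E/K)$, $L=K$, and $\pi_L$ a uniformizer of $K$. Let $\underline{s}=(s_1,\dots,s_j)$ be positive integers, at most one of them equal to $1$ and all others even, and let $\underline\kappa=(\kappa_1,\dots,\kappa_j)$ with $\kappa_i\in L_i^\times$, where $L_i,\eta_i,\pi_{L_i}$ denote the objects above for $s=s_i$. Let $V=V_{\underline s,\underline\kappa}=\prod_i E_{s_i}$ with the Hermitian form $$\phi(x,y)=\sum_i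 \mathrm{Tr}_{E_{s_i}/E}\Big(\frac{\kappa_i}{\pi_{L_i}}\,x_i\,\eta_i(y_i)\Big),$$ and let $T=\mathbf{T}_{\underline s,\underline\kappa}(K)=\prod_i\{\alpha\in E_{s_i}^\times : \mathrm{Nm}_{E_{s_i}/L_i}\alpha=1\}$ act on $V$ by multiplication. The building of $\mathrm{GL}(V)$ is the set of norms on the $E$-vector space $V$, that is, functions $\alpha:V\to\mathbb{R}\cup\{\infty\}$ with $\alpha(v+w)\ge\min(\alpha(v),\alpha(w))$, $\alpha(av)=v_E(a)+\alpha(v)$ and $\alpha(v)=\infty$ only for $v=0$, up to addition of real constants. The building $\mathcal{B}$ of $\mathrm{U}(V)$ is the set of classes fixed by the involution $[\alpha]\mapsto[\alpha^\vee]$, where $\alpha^\vee(v)=\inf_{w\ne0}\big(v_E(\phi(v,w))-\alpha(w)\big)$. For an $\mathcal{O}_E$-lattice $\Lambda\subset V$ put $\Lambda^\vee=\{v\in V:\phi(v,\lambda)\in\mathcal{O}_E\text{ for all }\lambda\in\Lambda\}$ and $\alpha_\Lambda(v)=\sup\{m\in\mathbb{Z}: v\in\pi_E^m\Lambda\}$.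 The vertices of $\mathcal{B}$ are the points $\big[\tfrac12(\alpha_\Lambda+\alpha_{\Lambda^\vee})\big]$ for the lattices $\Lambda$ with $\Lambda\supseteq\Lambda^\vee\supseteq\pi_E\Lambda$. **Theorem.** The group $T$ is compact and acts on $V$ through $\mathrm{U}(V)$, and it fixes a unique vertex $x$ of $\mathcal{B}$. This is the vertex given by the lattice $\Lambda=\prod_i\pi_E^{b_i}\mathcal{O}_{E_{s_i}}$, which satisfies $\Lambda\supseteq\Lambda^\vee\supseteq\pi_E\Lambda$, where $$b_i=\Big\lfloor\frac{1-v_{L_i}(\kappa_i)}{2}\Big\rfloor\ \text{ if } s_i \text{ is even},\qquad b_i=1-v_K(\kappa_i)\ \text{ if } s_i=1,$$ and $v_{L_i}$, $v_K$ are the normalized valuations of $L_i$, $K$. Moreover, $T$ fixes no point of $\mathcal{B}$ other than $x$. -/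

import Mathlib

noncomputable section

namespace UnitaryBuilding

/-! ### Norms on vector spaces, and the building of `GL(V)` -/

section Building

variable {E : Type*} [NormedField E] {V : Type*} [AddCommGroup V] [Module E V]

variable (E V) in
/-- A (non-archimedean) norm on the `E`-vector space `V`, written multiplicatively: the
additive norm `α : V → ℝ ∪ {∞}` with `α (v + w) ≥ min (α v) (α w)` and
`α (a v) = v_E a + α v` corresponds to `N v = ‖π_E‖ ^ α v`. -/
structure VNorm where
  toFun : V → ℝ
  eq_zero_iff : ∀ v, toFun v = 0 ↔ v = 0
  smul' : ∀ (a : E) (v : V), toFun (a • v) = ‖a‖ * toFun v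
  add_le_max' : ∀ v w : V, toFun (v + w) ≤ max (toFun v) (toFun w)

instance : CoeFun (VNorm E V) (fun _ => V → ℝ) := ⟨VNorm.toFun⟩

/-- Two norms are equivalent if they differ by a positive constant (additively: by the addition
of a real constant). -/
instance VNorm.setoid : Setoid (VNorm E V) where
  r N N' := ∃ c : ℝ, 0 < c ∧ ∀ v, N' v = c * N v
  iseqv :=
    { refl := fun N => ⟨1, one_pos, fun v => (one_mul _).symm⟩
      symm := by
        rintro N N' ⟨c, hc, h⟩
        exact ⟨c⁻¹, inv_pos.2 hc, fun v => by rw [h v, inv_mul_cancel_left₀ hc.ne']⟩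
      trans := by
        rintro N N' N'' ⟨c, hc, h⟩ ⟨d, hd, h'⟩
        exact ⟨d * c, mul_pos hd hc, fun v => by rw [h' v, h v, mul_assoc]⟩ }

variable (E V) in
/-- The (points of the) building of `GL(V)`: equivalence classes of norms on `V`. -/
def BuildingGL : Type _ := Quotient (VNorm.setoid (E := E) (V := V))

/-- The point of the building of `GL(V)` given by a norm. -/
def BuildingGL.mk (N : VNorm E V) : BuildingGL E V := Quotient.mk _ N

/-- The action of `GL(V)` on norms: `(g N)(v) = N (g⁻¹ v)`. -/
instance : MulAction (V ≃ₗ[E] V) (VNorm E V) where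
  smul g N :=
    { toFun := fun v => N (g.symm v)
      eq_zero_iff := fun v => by rw [N.eq_zero_iff, LinearEquiv.map_eq_zero_iff]
      smul' := fun a v => by rw [map_smul, N.smul']
      add_le_max' := fun v w => by rw [map_add]; exact N.add_le_max' _ _ }
  one_smul _ := rfl
  mul_smul _ _ _ := rfl

/-- The action of `GL(V)` on its building. -/
instance : MulAction (V ≃ₗ[E] V) (BuildingGL E V) where
  smul g := Quotient.map (fun N : VNorm E V => g • N)
    (fun _ _ ⟨c, hc, h⟩ => ⟨c, hc, fun v => h (g.symm v)⟩)
  one_smul x := by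
    induction x using Quotient.inductionOn
    rfl
  mul_smul g h x := by
    induction x using Quotient.inductionOn
    rfl

/-! ### Hermitian forms, unitary groups and their buildings -/

/-- The group `U(V)` of `E`-linear automorphisms of `V` that preserve the form `φ`. -/
def unitaryGroup (φ : V → V → E) : Subgroup (V ≃ₗ[E] V) where
  carrier := {g | ∀ v w, φ (g v) (g w) = φ v w}
  one_mem' _ _ := rfl
  mul_mem' {g h} hg hh v w := (hg (h v) (h w)).trans (hh v w)
  inv_mem' {g} hg v w := by
    have h := hg (g.symm v) (g.symm w)
    rw [g.apply_symm_apply, g.apply_symm_apply] at h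
    exact h.symm

/-- The dual of a norm with respect to `φ`; additively
`α^∨ v = inf_w (v_E (φ v w) - α w)`. The term for `w = 0` is `0`. -/
def dualNorm (φ : V → V → E) (N : VNorm E V) (v : V) : ℝ := ⨆ w : V, ‖φ v w‖ / N w

/-- The building of `U(V)`: the points of the building of `GL(V)` fixed by the involution
`[N] ↦ [N^∨]` given by the Hermitian form `φ`. -/
def buildingU (φ : V → V → E) : Set (BuildingGL E V) :=
  {x | ∃ N : VNorm E V, BuildingGL.mk N = x ∧
    ∃ c : ℝ, 0 < c ∧ ∀ v, dualNorm φ N v = c * N v}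

variable (E) in
/-- `Λ` is an `𝓞_E`-lattice in `V`: the `𝓞_E`-span of an `E`-basis of `V`. -/
def IsLattice (Λ : Set V) : Prop :=
  ∃ (n : ℕ) (e : Module.Basis (Fin n) E V), Λ = {v | ∀ i, ‖e.repr v i‖ ≤ 1}

/-- The dual `Λ^∨ = {v ∈ V | φ(v, w) ∈ 𝓞_E for all w ∈ Λ}`. -/
def dualLattice (φ : V → V → E) (Λ : Set V) : Set V := {v | ∀ w ∈ Λ, ‖φ v w‖ ≤ 1}

variable (E) in
/-- The norm of a lattice: `v ↦ min {‖a‖ | v ∈ a Λ}`. If `Λ` is the `𝓞_E`-span of a basis, this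
is the hyperspecial norm of that basis. -/
def latticeNorm (Λ : Set V) (v : V) : ℝ := sInf {t | ∃ a : E, ∃ w ∈ Λ, v = a • w ∧ t = ‖a‖}

/-- The lattices with `Λ ⊇ Λ^∨ ⊇ π_E Λ`. -/
def IsAlmostSelfDual (φ : V → V → E) (π : E) (Λ : Set V) : Prop :=
  IsLattice E Λ ∧ dualLattice φ Λ ⊆ Λ ∧ ∀ v ∈ Λ, π • v ∈ dualLattice φ Λ

/-- `x` is the vertex of the building of `U(V)` given by a lattice `Λ ⊇ Λ^∨ ⊇ π_E Λ`. If
`Λ = Λ^∨` or `Λ^∨ = π_E Λ`, this is the vertex `[Λ]` of the building of `GL(V)`; otherwise `Λ` and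
`Λ^∨` span an edge there, whose ends are exchanged by the involution, and `x` is its midpoint.
(For two adjacent lattices the midpoint is the class of the pointwise average of the additive
norms, which is the geometric mean of the multiplicative ones.) -/
def IsVertexOfLattice (φ : V → V → E) (π : E) (Λ : Set V) (x : BuildingGL E V) : Prop :=
  IsAlmostSelfDual φ π Λ ∧ ∃ N : VNorm E V, BuildingGL.mk N = x ∧
    ∀ v, N v = Real.sqrt (latticeNorm E Λ v * latticeNorm E (dualLattice φ Λ) v)

/-- `x` is a vertex of the building of `U(V)`. -/
def IsVertex (φ : V → V → E) (π : E) (x : BuildingGL E V) : Prop :=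
  ∃ Λ : Set V, IsVertexOfLattice φ π Λ x

end Building

/-! ### Fields -/

/-- `π` is a uniformizer of the discretely valued field `F`. -/
def IsUniformizer {F : Type*} [NormedField F] (π : F) : Prop :=
  π ≠ 0 ∧ ‖π‖ < 1 ∧ ∀ y : F, ‖y‖ < 1 → ‖y‖ ≤ ‖π‖

/-- The number of elements of the residue field of `F`. -/
def residueCard (F : Type*) [NormedField F] [IsUltrametricDist F] : ℕ :=
  Nat.card (IsLocalRing.ResidueField (NormedField.valuation (K := F)).valuationSubring)

variable {p : ℕ} [Fact p.Prime] {K : IntermediateField ℚ_[p] (PadicAlgCl p)}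

/-- The finite extension `F` of the `p`-adic field `K` is unramified: its ramification index
`[‖F^×‖ : ‖K^×‖]` is `1`. (Residue fields are finite, so residue extensions are separable.) -/
def IsUnramified (F : IntermediateField K (PadicAlgCl p)) : Prop :=
  ∀ x : F, ∃ y : K, ‖x‖ = ‖y‖

/-- The compositum `E · F`, as an extension of `E`. -/
def compositum (E F : IntermediateField K (PadicAlgCl p)) :
    IntermediateField E (PadicAlgCl p) :=
  IntermediateField.extendScalars (le_sup_left : E ≤ E ⊔ F)

section FixedFields

variable {M : Type*} [Field M] [Algebra K M]

/-- The fixed field of an automorphism `η`. -/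
abbrev fixedBy (η : M ≃ₐ[K] M) : IntermediateField K M :=
  IntermediateField.fixedField (Subgroup.zpowers η)

/-- The fixed field of two automorphisms `τ` and `ρ`. -/
abbrev fixedByPair (τ ρ : M ≃ₐ[K] M) : IntermediateField K M :=
  IntermediateField.fixedField (Subgroup.closure {τ, ρ})

theorem fixedByPair_le (τ ρ : M ≃ₐ[K] M) : fixedByPair τ ρ ≤ fixedBy (τ * ρ) := by
  apply IntermediateField.fixedField_le
  rw [Subgroup.zpowers_le]
  exact mul_mem (Subgroup.subset_closure (by simp)) (Subgroup.subset_closure (by simp))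

/-- The trace from the fixed field of `τ * ρ` to the fixed field of `τ` and `ρ`. -/
def traceToFixedByPair (τ ρ : M ≃ₐ[K] M) (x : fixedBy (τ * ρ)) : fixedByPair τ ρ :=
  Algebra.trace (fixedByPair τ ρ)
    (IntermediateField.extendScalars (fixedByPair_le τ ρ)) ⟨x.1, x.2⟩

end FixedFields

/-- The data of an elementary torus `T_s` (for `s = 2 r` even, or `s = 1`) and of a Hermitian
space `V_{s, κ}` on which it acts. -/
structure ElementaryDatum (E : IntermediateField K (PadicAlgCl p)) where
  /-- The dimension `s`, equal to `1` or even and positive. -/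
  s : ℕ
  s_eq : s = 1 ∨ (0 < s ∧ Even s)
  /-- The unramified extension `K_s` of `K` of degree `s`; `E_s` is `compositum E Ks`. -/
  Ks : IntermediateField K (PadicAlgCl p)
  finrank_Ks : Module.finrank K Ks = s
  unramified : IsUnramified Ks
  /-- `σ_s`, the Frobenius in `Gal(E_s/E)`, as an element of `Gal(E_s/K)`. -/
  σ : compositum E Ks ≃ₐ[K] compositum E Ks
  σ_fixes : ∀ x : E, σ (algebraMap E (compositum E Ks) x) = algebraMap E (compositum E Ks) x
  σ_frob : ∀ x : compositum E Ks, ‖x‖ ≤ 1 → ‖σ x - x ^ residueCard E‖ < 1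
  /-- `τ_s`, the nontrivial element of `Gal(E_s/K_s)`, as an element of `Gal(E_s/K)`. -/
  τ : compositum E Ks ≃ₐ[K] compositum E Ks
  τ_fixes : ∀ x : compositum E Ks, (x : PadicAlgCl p) ∈ Ks → τ x = x
  τ_ne_one : τ ≠ 1
  /-- The uniformizer `π_L` of `L`, the fixed field of `η_s = τ_s σ_s ^ r` in `E_s`. For `s = 1`
  one has `η = τ` (as `1 / 2 = 0` in `ℕ`), `E_s = E`, `L = K`, and `π_L` is a uniformizer
  of `K`. -/
  πL : fixedBy (τ * σ ^ (s / 2))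
  πL_uniformizer : IsUniformizer πL
  /-- For `s = 2 r`, `Tr_{L/K_r} π_L = 0`, where `K_r`, as a subfield of `E_s`, is the fixed field
  of `⟨τ_s, σ_s ^ r⟩ = Gal(E_s/K_r)`. -/
  trace_πL : Even s → traceToFixedByPair τ (σ ^ (s / 2)) πL = 0
  /-- The parameter `κ ∈ L^×` of the Hermitian form. -/
  κ : fixedBy (τ * σ ^ (s / 2))
  κ_ne_zero : κ ≠ 0

namespace ElementaryDatum

variable {E : IntermediateField K (PadicAlgCl p)} (D : ElementaryDatum E)

/-- The field `E_s = E · K_s`, which is also the `E`-vector space `V_{s, κ}`. -/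
abbrev Es : IntermediateField E (PadicAlgCl p) := compositum E D.Ks

/-- The involution `η_s = τ_s σ_s ^ r` of `E_s`, where `s = 2 r` (and `η = τ` if `s = 1`). -/
def η : D.Es ≃ₐ[K] D.Es := D.τ * D.σ ^ (D.s / 2)

/-- The fixed field `L` of `η_s` in `E_s`. -/
abbrev L : IntermediateField K D.Es := fixedBy D.η

end ElementaryDatum

section Product

variable {E : IntermediateField K (PadicAlgCl p)} {j : ℕ} (D : Fin j → ElementaryDatum E)

/-- The space `V = ∏ i, E_{s_i}`. -/
abbrev Space : Type := ∀ i, (D i).Es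

/-- The Hermitian form on `V`: the orthogonal sum of the forms
`Tr_{E_{s_i}/E} ((κ_i / π_{L_i}) x η(y))`. -/
def hermForm (v w : Space D) : E :=
  ∑ i, Algebra.trace E (D i).Es
    ((((D i).κ : (D i).Es) / ((D i).πL : (D i).Es)) * v i * (D i).η (w i))

/-- The group `T(K) = ∏ i, {α ∈ E_{s_i}^× | Nm_{E_{s_i}/L_i} α = 1}`. -/
def torus : Subgroup (Space D)ˣ where
  carrier := {t | ∀ i, Algebra.norm (D i).L ((t : Space D) i) = 1}
  one_mem' i := by simp
  mul_mem' {a b} ha hb i := by simp [ha i, hb i]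
  inv_mem' {a} ha i := by
    have h : Algebra.norm (D i).L ((a : Space D) i * ((a⁻¹ : (Space D)ˣ) : Space D) i) = 1 := by
      rw [← Pi.mul_apply, Units.mul_inv, Pi.one_apply, map_one]
    rwa [map_mul, ha i, one_mul] at h

/-- The action of `V^×` on `V = ∏ i, E_{s_i}` by multiplication, as a map to `GL(V)`. -/
def mulAut : (Space D)ˣ →* (Space D ≃ₗ[E] Space D) where
  toFun t :=
    { toFun := fun v => t.1 * v
      map_add' := mul_add t.1
      map_smul' := fun a v => mul_smul_comm a t.1 v
      invFun := fun v => t⁻¹.1 * v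
      left_inv := fun v => Units.inv_mul_cancel_left t v
      right_inv := fun v => Units.mul_inv_cancel_left t v }
  map_one' := LinearEquiv.ext fun v => one_mul v
  map_mul' t u := LinearEquiv.ext fun v => mul_assoc t.1 u.1 v

/-- The image of `T(K)` in `GL(V)`: an element of `T(K)` acts on `V` by multiplication. -/
def torusGL : Subgroup (Space D ≃ₗ[E] Space D) := (torus D).map (mulAut D)

/-- The lattice `∏ i, π_E ^ (b i) 𝓞_{E_{s_i}}` in `V`. -/
def prodLattice (π : E) (b : Fin j → ℤ) : Set (Space D) :=
  {v | ∀ i, ∃ y : (D i).Es, ‖y‖ ≤ 1 ∧ v i = (π ^ b i) • y}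

end Product

end UnitaryBuilding

end

noncomputable section

namespace UnitaryBuilding

/-! ### Residue fields of ultrametric fields -/

section Residue

/-! `K_s/K` is unramified and `E/K` is ramified, so each element of `E_s` is `a + bπ` with `a, b` in
`K_s`, and nonzero terms have different norms (`norm_add_mul_uniformizer`). Hence `E_s/E` keeps the
value group: it has an orthonormal basis, its degree is the residue degree
(`exists_orthonormal_basis`), and some unit has unit trace (`exists_norm_trace_eq_one`). So the
`i`-th form is bounded sharply by `m_i ‖x‖ ‖y‖` with `m_i = ‖κ_i/π_{L_i}‖ = ‖π‖ ^ e_i`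
(`isSplitForm_hermForm`).

Let `T` fix the class of a norm `N`. As `T` is bounded, it preserves `N` itself
(`VNorm.invariant_of_mul`). The elements of `T` that are `-1` in one factor and `1` in the others,
together with `‖2‖ = 1`, show that `N` is the maximum of its restrictions to the factors
(`VNorm.eq_maxVNorm`). If `s = 1`, the factor is a line. If `s` is even, its residue field has `m ^
2` elements and `η` acts on it by `x ↦ x ^ m`; the elements `η x / x` reduce to the `(m - 1)`-st
powers, which are more than `m` classes and so generate the residue field. Successive approximation
then shows that all integers of `E_s` contract `N`, which is thus a multiple of the absolute value
(`VNorm.eq_mul_of_normOne_invariant`). Only one weight `c_i` per factor remains free.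

Duality replaces `c_i` by `m_i / c_i` (`dualNorm_maxVNorm`), so a fixed point of the building has
`c_i` proportional to `√m_i`: there is exactly one. For a fixed vertex, `Λ` is a ball of the vertex
norm (`IsAlmostSelfDual.mem_iff`), hence a box of radii `‖π‖ ^ b_i`, and the inclusions say `2 b_i ≤
-e_i ≤ 2 b_i + 1`. The stated exponents come from `‖π_L‖ = ‖π‖` for `s` even and `‖π_L‖ = ‖π‖ ^ 2`
for `s = 1`. -/

theorem norm_mul_le_one {F : Type*} [NormedField F] {x y : F} (hx : ‖x‖ ≤ 1) (hy : ‖y‖ ≤ 1) : ‖x * y‖ ≤ 1 := by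
  rw [norm_mul]; exact mul_le_one₀ hx (norm_nonneg _) hy

theorem norm_pow_le_one {F : Type*} [NormedField F] {x : F} (hx : ‖x‖ ≤ 1) (n : ℕ) : ‖x ^ n‖ ≤ 1 := by
  rw [norm_pow]; exact pow_le_one₀ (norm_nonneg _) hx

variable {F : Type*} [NormedField F] [IsUltrametricDist F]

variable (F) in
/-- The residue field of an ultrametric normed field. -/
abbrev ResField : Type _ :=
  IsLocalRing.ResidueField (NormedField.valuation (K := F)).valuationSubring

theorem mem_integers_iff {x : F} :
    x ∈ (NormedField.valuation (K := F)).valuationSubring ↔ ‖x‖ ≤ 1 := Iff.rfl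

open Classical in
/-- Reduction of an element of norm at most `1` to the residue field, extended by zero. -/
def red (x : F) : ResField F :=
  if h : ‖x‖ ≤ 1 then IsLocalRing.residue _ ⟨x, mem_integers_iff.2 h⟩ else 0

theorem red_of_le {x : F} (h : ‖x‖ ≤ 1) :
    red x = IsLocalRing.residue (NormedField.valuation (K := F)).valuationSubring
      ⟨x, mem_integers_iff.2 h⟩ := dif_pos h

theorem norm_add_le_one {x y : F} (hx : ‖x‖ ≤ 1) (hy : ‖y‖ ≤ 1) : ‖x + y‖ ≤ 1 :=
  (IsUltrametricDist.norm_add_le_max x y).trans (max_le hx hy)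

theorem norm_sub_le_one {x y : F} (hx : ‖x‖ ≤ 1) (hy : ‖y‖ ≤ 1) : ‖x - y‖ ≤ 1 := by
  rw [sub_eq_add_neg]; exact norm_add_le_one hx (by rwa [norm_neg])

theorem isUnit_integers_iff (x : (NormedField.valuation (K := F)).valuationSubring) :
    IsUnit x ↔ ‖(x : F)‖ = 1 := by
  constructor
  · rintro ⟨u, rfl⟩
    have h : ((u : (NormedField.valuation (K := F)).valuationSubring) : F) * (↑(u⁻¹) :
        (NormedField.valuation (K := F)).valuationSubring) = 1 := by
      rw [← MulMemClass.coe_mul, Units.mul_inv]; rfl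
    have h1 : ‖((u : (NormedField.valuation (K := F)).valuationSubring) : F)‖ ≤ 1 :=
      mem_integers_iff.1 (u : (NormedField.valuation (K := F)).valuationSubring).2
    have h2 : ‖((↑(u⁻¹) : (NormedField.valuation (K := F)).valuationSubring) : F)‖ ≤ 1 :=
      mem_integers_iff.1 (↑(u⁻¹) : (NormedField.valuation (K := F)).valuationSubring).2
    have h3 := congrArg norm h
    rw [norm_mul, norm_one] at h3
    refine le_antisymm h1 ?_
    rw [← h3]
    exact mul_le_of_le_one_right (norm_nonneg _) h2
  · intro h
    have h0 : (x : F) ≠ 0 := by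
      intro h0; rw [h0, norm_zero] at h; exact zero_ne_one h
    refine IsUnit.of_mul_eq_one ⟨(x : F)⁻¹, mem_integers_iff.2 (by rw [norm_inv, h, inv_one])⟩ ?_
    ext
    exact mul_inv_cancel₀ h0

theorem red_eq_zero_iff {x : F} (h : ‖x‖ ≤ 1) : red x = 0 ↔ ‖x‖ < 1 := by
  rw [red_of_le h, IsLocalRing.residue_eq_zero_iff, IsLocalRing.mem_maximalIdeal, mem_nonunits_iff,
    isUnit_integers_iff]
  exact ⟨fun h' => lt_of_le_of_ne h h', fun h' => h'.ne⟩

theorem red_add {x y : F} (hx : ‖x‖ ≤ 1) (hy : ‖y‖ ≤ 1) : red (x + y) = red x + red y := by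
  rw [red_of_le hx, red_of_le hy, red_of_le (norm_add_le_one hx hy), ← map_add]; rfl

theorem red_sub {x y : F} (hx : ‖x‖ ≤ 1) (hy : ‖y‖ ≤ 1) : red (x - y) = red x - red y := by
  rw [red_of_le hx, red_of_le hy, red_of_le (norm_sub_le_one hx hy), ← map_sub]; rfl

theorem red_mul {x y : F} (hx : ‖x‖ ≤ 1) (hy : ‖y‖ ≤ 1) : red (x * y) = red x * red y := by
  rw [red_of_le hx, red_of_le hy, red_of_le (norm_mul_le_one hx hy), ← map_mul]; rfl

theorem red_one : red (1 : F) = 1 := by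
  rw [red_of_le (norm_one.le)]; exact map_one _

theorem red_zero : red (0 : F) = 0 := by
  rw [red_of_le (by simp)]; exact map_zero _

theorem red_pow {x : F} (hx : ‖x‖ ≤ 1) (n : ℕ) : red (x ^ n) = red x ^ n := by
  induction n with
  | zero => simp [red_one]
  | succ n ih => rw [pow_succ, red_mul (norm_pow_le_one hx n) hx, ih, pow_succ]

theorem norm_sum_le_one {ι : Type*} (s : Finset ι) {f : ι → F} (h : ∀ i ∈ s, ‖f i‖ ≤ 1) :
    ‖∑ i ∈ s, f i‖ ≤ 1 :=
  IsUltrametricDist.norm_sum_le_of_forall_le_of_nonneg zero_le_one h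

theorem red_sum {ι : Type*} (s : Finset ι) {f : ι → F} (h : ∀ i ∈ s, ‖f i‖ ≤ 1) :
    red (∑ i ∈ s, f i) = ∑ i ∈ s, red (f i) := by
  classical
  induction s using Finset.induction_on with
  | empty => simp [red_zero]
  | insert a s ha ih =>
    rw [Finset.sum_insert ha, Finset.sum_insert ha,
      red_add (h a (Finset.mem_insert_self a s))
        (norm_sum_le_one s fun i hi => h i (Finset.mem_insert_of_mem hi)),
      ih fun i hi => h i (Finset.mem_insert_of_mem hi)]

theorem red_eq_iff {x y : F} (hx : ‖x‖ ≤ 1) (hy : ‖y‖ ≤ 1) : red x = red y ↔ ‖x - y‖ < 1 := by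
  rw [← red_eq_zero_iff (norm_sub_le_one hx hy), red_sub hx hy, sub_eq_zero]

theorem exists_red_eq (a : ResField F) : ∃ x : F, ‖x‖ ≤ 1 ∧ red x = a := by
  obtain ⟨x, rfl⟩ := IsLocalRing.residue_surjective a
  exact ⟨x, mem_integers_iff.1 x.2, red_of_le (mem_integers_iff.1 x.2)⟩

/-- A proper space has a finite residue field. -/
theorem finite_resField [ProperSpace F] : Finite (ResField F) := by
  have h := (isCompact_closedBall (0 : F) 1).totallyBounded
  obtain ⟨t, ht, hcov⟩ := Metric.totallyBounded_iff.1 h 1 one_pos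
  have hfin : (red '' t).Finite := ht.image _
  obtain ⟨t', ht', ht'sub, hcov'⟩ : ∃ t' : Set F, t'.Finite ∧ (∀ y ∈ t', ‖y‖ ≤ 1) ∧
      ∀ x : F, ‖x‖ ≤ 1 → ∃ y ∈ t', ‖x - y‖ < 1 := by
    -- Centres outside the unit ball can be dropped: by the ultrametric inequality an open ball of
    -- radius 1 that meets the unit ball has its centre there.
    refine ⟨t ∩ {y | ‖y‖ ≤ 1}, ht.inter_of_left _, fun y hy => hy.2, fun x hx => ?_⟩
    have := hcov (show x ∈ Metric.closedBall (0 : F) 1 by simpa using hx)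
    simp only [Set.mem_iUnion, Metric.mem_ball, dist_eq_norm] at this
    obtain ⟨y, hy, hxy⟩ := this
    refine ⟨y, ⟨hy, ?_⟩, hxy⟩
    have : y = x - (x - y) := by ring
    rw [Set.mem_ofPred_eq, this]
    exact norm_sub_le_one hx hxy.le
  refine Set.finite_univ_iff.1 ((ht'.image red).subset fun a _ => ?_)
  obtain ⟨x, hx, rfl⟩ := exists_red_eq a
  obtain ⟨y, hy, hxy⟩ := hcov' x hx
  exact ⟨y, hy, ((red_eq_iff hx (ht'sub y hy)).2 hxy).symm⟩

/-- A nonzero polynomial has at most as many roots as its degree, and every residue class lifts.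
This counting argument yields the order of Frobenius, units of unit trace, and elements of given
norm fixed by an involution. -/
theorem exists_eval_red_ne_zero [Finite (ResField F)] {P : Polynomial (ResField F)} (hP : P ≠ 0)
    (hdeg : P.natDegree < residueCard F) : ∃ x : F, ‖x‖ ≤ 1 ∧ P.eval (red x) ≠ 0 := by
  classical
  by_contra! h
  have := Fintype.ofFinite (ResField F)
  have hle : (Finset.univ : Finset (ResField F)).card ≤ P.natDegree := by
    refine Polynomial.card_le_degree_of_subset_roots fun a _ => ?_
    obtain ⟨x, hx, rfl⟩ := exists_red_eq a
    exact (Polynomial.mem_roots hP).2 (h x hx)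
  have : residueCard F = Fintype.card (ResField F) := Nat.card_eq_fintype_card
  rw [Finset.card_univ] at hle
  omega

theorem one_lt_residueCard [Finite (ResField F)] : 1 < residueCard F := Finite.one_lt_card

/-- The Frobenius powers `x ↦ x ^ m` and the identity differ on the residue field for
`1 < m < #k`. -/
theorem exists_one_le_norm_pow_sub [Finite (ResField F)] {m : ℕ} (hm : 1 < m)
    (hlt : m < residueCard F) : ∃ x : F, ‖x‖ ≤ 1 ∧ ¬ ‖x ^ m - x‖ < 1 := by
  have hdeg : (Polynomial.X ^ m - Polynomial.X : Polynomial (ResField F)).natDegree = m :=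
    FiniteField.X_pow_card_sub_X_natDegree_eq (ResField F) hm
  obtain ⟨x, hx, hne⟩ := exists_eval_red_ne_zero
    (P := (Polynomial.X ^ m - Polynomial.X : Polynomial (ResField F)))
    (FiniteField.X_pow_card_sub_X_ne_zero (ResField F) hm) (by rwa [hdeg])
  refine ⟨x, hx, fun h => hne ?_⟩
  rw [Polynomial.eval_sub, Polynomial.eval_pow, Polynomial.eval_X, ← red_pow hx, sub_eq_zero]
  exact (red_eq_iff (norm_pow_le_one hx m) hx).2 h

end Residue

/-! ### Discretely valued fields -/

section Uniformizer

variable {F : Type*} [NormedField F] {π : F}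

theorem IsUniformizer.norm_pos (hπ : IsUniformizer π) : 0 < ‖π‖ := norm_pos_iff.2 hπ.1

/-- A norm strictly between consecutive powers of `‖π‖` could be scaled by a power of `π` into the
open interval from `‖π‖` to 1, which contains no norm. -/
theorem IsUniformizer.exists_norm_eq_zpow (hπ : IsUniformizer π) {x : F} (hx : x ≠ 0) :
    ∃ n : ℤ, ‖x‖ = ‖π‖ ^ n := by
  obtain ⟨n, hn1, hn2⟩ := exists_mem_Ioc_zpow (norm_pos_iff.2 hx)
    ((one_lt_inv₀ hπ.norm_pos).2 hπ.2.1)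
  refine ⟨-(n + 1), le_antisymm ?_ ?_⟩
  · rw [zpow_neg, ← inv_zpow]; exact hn2
  · by_contra! hlt
    have h0 : (0 : ℝ) < ‖π‖ := hπ.norm_pos
    have h1 : ‖x * π ^ (n + 1)‖ < 1 := by
      rw [norm_mul, norm_zpow]
      calc ‖x‖ * ‖π‖ ^ (n + 1) < ‖π‖ ^ (-(n + 1)) * ‖π‖ ^ (n + 1) := by gcongr
        _ = 1 := by rw [← zpow_add₀ h0.ne', neg_add_cancel, zpow_zero]
    have h2 := hπ.2.2 _ h1
    rw [norm_mul, norm_zpow, zpow_add_one₀ h0.ne', ← mul_assoc] at h2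
    have h3 : ‖x‖ * ‖π‖ ^ n ≤ 1 := le_of_mul_le_mul_right (by simpa using h2) h0
    rw [inv_zpow] at hn1
    have h4 : 0 < ‖π‖ ^ n := zpow_pos h0 n
    rw [inv_lt_iff_one_lt_mul₀ h4] at hn1
    linarith [mul_comm ‖x‖ (‖π‖ ^ n)]

theorem IsUniformizer.zpow_lt_zpow_iff (hπ : IsUniformizer π) {m n : ℤ} :
    ‖π‖ ^ m < ‖π‖ ^ n ↔ n < m := zpow_lt_zpow_iff_right_of_lt_one₀ hπ.norm_pos hπ.2.1

theorem IsUniformizer.zpow_le_zpow_iff (hπ : IsUniformizer π) {m n : ℤ} :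
    ‖π‖ ^ m ≤ ‖π‖ ^ n ↔ n ≤ m := zpow_le_zpow_iff_right_of_lt_one₀ hπ.norm_pos hπ.2.1

theorem IsUniformizer.zpow_inj (hπ : IsUniformizer π) {m n : ℤ} :
    ‖π‖ ^ m = ‖π‖ ^ n ↔ m = n := zpow_right_inj₀ hπ.norm_pos hπ.2.1.ne

end Uniformizer

/-! ### Unramified extensions of discretely valued fields -/

section Extension

variable {F M : Type*} [NormedField F] [IsUltrametricDist F] [NormedField M] [IsUltrametricDist M]
  [Algebra F M]

/-- The extension of residue fields. -/
def resFieldMap (hnorm : ∀ a : F, ‖algebraMap F M a‖ = ‖a‖) : ResField F →+* ResField M :=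
  letI f : (NormedField.valuation (K := F)).valuationSubring →+*
      (NormedField.valuation (K := M)).valuationSubring :=
    ((algebraMap F M).comp (NormedField.valuation (K := F)).valuationSubring.subtype).codRestrict
      _ (fun x => mem_integers_iff.2 ((hnorm x).le.trans (mem_integers_iff.1 x.2)))
  haveI : IsLocalHom f := ⟨fun a ha => by
    rw [isUnit_integers_iff] at ha ⊢
    rw [← ha]; exact (hnorm a).symm⟩
  IsLocalRing.ResidueField.map f

theorem resFieldMap_red (hnorm : ∀ a : F, ‖algebraMap F M a‖ = ‖a‖) {a : F} (ha : ‖a‖ ≤ 1) :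
    resFieldMap hnorm (red a) = red (algebraMap F M a) := by
  rw [red_of_le ha, red_of_le ((hnorm a).le.trans ha)]
  rfl

/-- An extension of a complete discretely valued field with the same value group and
finite residue field has an orthonormal basis, and its degree is its residue degree. -/
theorem exists_orthonormal_basis [CompleteSpace F] [FiniteDimensional F M] [Finite (ResField M)]
    (hnorm : ∀ a : F, ‖algebraMap F M a‖ = ‖a‖) {π : F} (hπ : IsUniformizer π)
    (hval : ∀ x : M, ∃ a : F, ‖x‖ = ‖a‖) :
    residueCard M = residueCard F ^ Module.finrank F M ∧
    ∃ β : Module.Basis (Fin (Module.finrank F M)) F M, (∀ i, ‖β i‖ ≤ 1) ∧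
      ∀ x i, ‖β.repr x i‖ ≤ ‖x‖ := by
  let := (resFieldMap hnorm).toAlgebra
  have hsm : ∀ (a : F) (x : M), ‖a • x‖ = ‖a‖ * ‖x‖ := fun a x => by
    rw [Algebra.smul_def, norm_mul, hnorm]
  set f := Module.finrank (ResField F) (ResField M) with hf
  let b := Module.finBasis (ResField F) (ResField M)
  choose β hβ1 hβ using fun i => exists_red_eq (b i)
  have hred : ∀ c : Fin f → F, (∀ i, ‖c i‖ ≤ 1) →
      red (∑ i, c i • β i) = ∑ i, red (c i) • b i := by
    intro c hc
    rw [red_sum _ (fun i _ => ?_)]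
    · refine Finset.sum_congr rfl fun i _ => ?_
      rw [Algebra.smul_def, Algebra.smul_def, red_mul ((hnorm _).le.trans (hc i)) (hβ1 i), hβ i]
      congr 1
      exact (resFieldMap_red hnorm (hc i)).symm
    · rw [hsm]; exact mul_le_one₀ (hc i) (norm_nonneg _) (hβ1 i)
  -- Divide by a coefficient of largest norm: the sum then reduces to a nontrivial combination of
  -- the residue basis, so its norm cannot drop below 1.
  have horth : ∀ c : Fin f → F, ∀ i, ‖c i‖ ≤ ‖∑ i, c i • β i‖ := by
    intro c i
    obtain ⟨i₀, -, hi₀⟩ := Finset.exists_max_image Finset.univ (fun i => ‖c i‖) ⟨i, Finset.mem_univ i⟩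
    refine (hi₀ i (Finset.mem_univ i)).trans ?_
    by_cases h0 : c i₀ = 0
    · rw [h0, norm_zero]; exact norm_nonneg _
    have h0' : 0 < ‖c i₀‖ := norm_pos_iff.2 h0
    have hc : ∀ i, ‖(c i₀)⁻¹ * c i‖ ≤ 1 := fun i => by
      rw [norm_mul, norm_inv, inv_mul_le_iff₀ h0', mul_one]
      exact hi₀ i (Finset.mem_univ i)
    have hs : ∑ i, ((c i₀)⁻¹ * c i) • β i = (c i₀)⁻¹ • ∑ i, c i • β i := by
      rw [Finset.smul_sum]; simp only [mul_smul]
    have hr := hred _ hc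
    rw [hs] at hr
    by_contra! hlt
    have hlt' : ‖(c i₀)⁻¹ • ∑ i, c i • β i‖ < 1 := by
      rw [hsm, norm_inv, inv_mul_lt_iff₀ h0', mul_one]; exact hlt
    rw [(red_eq_zero_iff hlt'.le).2 hlt'] at hr
    have := Fintype.linearIndependent_iff.1 b.linearIndependent _ hr.symm i₀
    rw [inv_mul_cancel₀ h0, red_one] at this
    exact one_ne_zero this
  have hli : LinearIndependent F β := by
    rw [Fintype.linearIndependent_iff]
    intro c hc i
    have := horth c i
    rw [hc, norm_zero] at this
    exact norm_le_zero_iff.1 this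
  set W := Submodule.span F (Set.range β) with hW
  -- Scale `x` to norm 1 by an element of `F` and match its residue class in `W`; the error has norm
  -- below 1, and this norm is a value of `F`, so it is at most `‖π‖`.
  have happrox : ∀ x : M, ∃ w ∈ W, ‖x - w‖ ≤ ‖π‖ * ‖x‖ := by
    intro x
    by_cases hx : x = 0
    · exact ⟨0, W.zero_mem, by simp [hx]⟩
    obtain ⟨a, ha⟩ := hval x
    have ha0 : a ≠ 0 := by rintro rfl; exact hx (norm_eq_zero.1 (by simpa using ha))
    have hx1 : ‖a⁻¹ • x‖ ≤ 1 := by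
      rw [hsm, norm_inv, ha, inv_mul_cancel₀ (norm_ne_zero_iff.2 ha0)]
    choose c hc1 hc using fun i => exists_red_eq (b.repr (red (a⁻¹ • x)) i)
    have h1 : red (a⁻¹ • x) = red (∑ i, c i • β i) := by
      rw [hred c hc1]; simp only [hc]; exact (b.sum_repr _).symm
    rw [red_eq_iff hx1 (norm_sum_le_one _ fun i _ => by
      rw [hsm]; exact mul_le_one₀ (hc1 i) (norm_nonneg _) (hβ1 i))] at h1
    refine ⟨a • ∑ i, c i • β i, W.smul_mem _ (W.sum_mem fun i _ =>
      W.smul_mem _ (Submodule.subset_span ⟨i, rfl⟩)), ?_⟩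
    obtain ⟨d, hd⟩ := hval (a⁻¹ • x - ∑ i, c i • β i)
    have hd' := hπ.2.2 d (hd ▸ h1)
    have : x - a • ∑ i, c i • β i = a • (a⁻¹ • x - ∑ i, c i • β i) := by
      rw [smul_sub, smul_inv_smul₀ ha0]
    rw [this, hsm, hd, ha, mul_comm]
    exact mul_le_mul_of_nonneg_right hd' (norm_nonneg _)
  have happrox' : ∀ (x : M) (n : ℕ), ∃ w ∈ W, ‖x - w‖ ≤ ‖π‖ ^ n * ‖x‖ := by
    intro x n
    induction n with
    | zero => exact ⟨0, W.zero_mem, by simp⟩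
    | succ n ih =>
      obtain ⟨w, hw, h⟩ := ih
      obtain ⟨w', hw', h'⟩ := happrox (x - w)
      refine ⟨w + w', W.add_mem hw hw', ?_⟩
      rw [← sub_sub, pow_succ', mul_assoc]
      exact h'.trans (mul_le_mul_of_nonneg_left h (norm_nonneg _))
  -- `W` is dense by `happrox'`, and closed because it is finite-dimensional over a complete field.
  have hspan : ∀ x : M, x ∈ W := by
    let : NontriviallyNormedField F :=
      { ‹NormedField F› with
        non_trivial := ⟨π⁻¹, by rw [norm_inv]; exact (one_lt_inv₀ hπ.norm_pos).2 hπ.2.1⟩ }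
    let : NormedSpace F M := { norm_smul_le := fun a x => (hsm a x).le }
    have hcl : IsClosed (W : Set M) := Submodule.closed_of_finiteDimensional W
    intro x
    rw [← SetLike.mem_coe, ← hcl.closure_eq, Metric.mem_closure_iff]
    intro ε hε
    have ht : Filter.Tendsto (fun n : ℕ => ‖π‖ ^ n * ‖x‖) Filter.atTop (nhds (0 * ‖x‖)) :=
      (tendsto_pow_atTop_nhds_zero_of_lt_one (norm_nonneg _) hπ.2.1).mul_const _
    rw [zero_mul] at ht
    obtain ⟨n, hn⟩ := (ht.eventually_lt_const hε).exists
    obtain ⟨w, hw, h⟩ := happrox' x n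
    exact ⟨w, hw, by rw [dist_eq_norm]; exact h.trans_lt hn⟩
  let B : Module.Basis (Fin f) F M := Module.Basis.mk hli (fun x _ => hspan x)
  have hfn : Module.finrank F M = f := by simpa using Module.finrank_eq_card_basis B
  refine ⟨?_, ?_⟩
  · rw [hfn]; exact Module.natCard_eq_pow_finrank
  · rw [hfn]
    refine ⟨B, fun i => ?_, fun x i => ?_⟩
    · rw [Module.Basis.mk_apply]; exact hβ1 i
    · have := horth (fun i => B.repr x i) i
      have h2 : ∑ i, B.repr x i • β i = x := by
        conv_rhs => rw [← B.sum_repr x]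
        simp only [B, Module.Basis.mk_apply]
      rwa [h2] at this

end Extension

/-! ### The Frobenius of an unramified extension -/

section Frobenius

variable {M : Type*} [NormedField M] [IsUltrametricDist M]

theorem norm_iterate {M : Type*} [Norm M] {ρ : M → M} (h : ∀ x, ‖ρ x‖ = ‖x‖) (n : ℕ) (x : M) :
    ‖ρ^[n] x‖ = ‖x‖ := by
  induction n generalizing x with
  | zero => rfl
  | succ n ih => rw [Function.iterate_succ_apply, ih, h]

/-- An automorphism that is isometric and acts on the residue field by `x ↦ x ^ m`. -/
def ActsAsPow (ρ : M → M) (m : ℕ) : Prop := ∀ x, ‖x‖ ≤ 1 → ‖ρ x‖ ≤ 1 ∧ red (ρ x) = red x ^ m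

theorem ActsAsPow.comp {ρ ρ' : M → M} {m m' : ℕ} (h : ActsAsPow ρ m) (h' : ActsAsPow ρ' m') :
    ActsAsPow (ρ ∘ ρ') (m * m') := fun x hx =>
  ⟨(h _ (h' x hx).1).1, by
    rw [Function.comp_apply, (h _ (h' x hx).1).2, (h' x hx).2, ← pow_mul, mul_comm]⟩

theorem ActsAsPow.iterate {ρ : M → M} {m : ℕ} (h : ActsAsPow ρ m) (n : ℕ) :
    ActsAsPow ρ^[n] (m ^ n) := by
  induction n with
  | zero => exact fun x hx => ⟨hx, by simp⟩
  | succ n ih => rw [Function.iterate_succ, pow_succ]; exact ih.comp h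

theorem ActsAsPow.congr {ρ ρ' : M → M} {m : ℕ} (h : ActsAsPow ρ m) (h' : ∀ x, ρ x = ρ' x) :
    ActsAsPow ρ' m := by
  rwa [← funext h']

theorem actsAsPow_of_norm_sub_lt {ρ : M → M} {m : ℕ} (hρ : ∀ x, ‖ρ x‖ = ‖x‖)
    (h : ∀ x, ‖x‖ ≤ 1 → ‖ρ x - x ^ m‖ < 1) : ActsAsPow ρ m := fun x hx => by
  have h1 : ‖ρ x‖ ≤ 1 := (hρ x).le.trans hx
  exact ⟨h1, by rw [← red_pow hx]; exact (red_eq_iff h1 (norm_pow_le_one hx m)).2 (h x hx)⟩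

/-- If `x ↦ x ^ m` is the identity of the residue field and `0 < m < #k`, then `m = 1`. -/
theorem ActsAsPow.eq_one [Finite (ResField M)] {m : ℕ} (h : ActsAsPow (id : M → M) m)
    (h0 : 0 < m) (hlt : m < residueCard M) : m = 1 := by
  by_contra hne
  obtain ⟨x, hx, hx'⟩ := exists_one_le_norm_pow_sub (F := M) (m := m) (by omega) hlt
  refine hx' ((red_eq_iff (norm_pow_le_one hx m) hx).1 ?_)
  rw [red_pow hx, ← (h x hx).2, id]

theorem red_pow_residueCard [Finite (ResField M)] (x : M) : red x ^ residueCard M = red x := by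
  have := Fintype.ofFinite (ResField M)
  have h : residueCard M = Fintype.card (ResField M) := Nat.card_eq_fintype_card
  rw [h, FiniteField.pow_card]

/-- The degree formula excludes the value 0 that `Nat.card` gives to infinite types, so finiteness
of the smaller residue field is not needed. -/
theorem one_lt_residueCard_of_pow {F : Type*} [NormedField F] [IsUltrametricDist F] [Algebra F M]
    [Finite (ResField M)]
    (hq : residueCard M = residueCard F ^ Module.finrank F M) :
    1 < residueCard F := by
  have h1 := one_lt_residueCard (F := M)
  by_contra! h
  rw [hq] at h1
  interval_cases hc : residueCard F
  · rcases Nat.eq_zero_or_pos (Module.finrank F M) with h | h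
    · simp [h] at h1
    · simp [zero_pow h.ne'] at h1
  · simp at h1

variable {F : Type*} [NormedField F] [IsUltrametricDist F] [Algebra F M] [FiniteDimensional F M]
  [Finite (ResField M)]

/-- If `σ ^ n = 1` with `0 < n` below the degree, then `x ↦ x ^ (q ^ n)` would be the identity on a
field of more than `q ^ n` elements. -/
theorem le_orderOf_frobenius (hq : residueCard M = residueCard F ^ Module.finrank F M)
    {σ : M ≃ₐ[F] M} (hσ : ActsAsPow σ (residueCard F)) : Module.finrank F M ≤ orderOf σ := by
  by_contra! hlt
  have h1 := one_lt_residueCard_of_pow hq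
  have hpos : 0 < orderOf σ := orderOf_pos σ
  have h := (hσ.iterate (orderOf σ)).congr (ρ' := id) fun x => by
    rw [← AlgEquiv.coe_pow, pow_orderOf_eq_one]; rfl
  have := h.eq_one (by positivity) (by rw [hq]; exact Nat.pow_lt_pow_right h1 hlt)
  exact absurd this (Nat.one_lt_pow hpos.ne' h1).ne'

/-- The chain degree ≤ order of `σ` ≤ number of automorphisms ≤ degree closes up. The extension is
therefore cyclic Galois, without Galois being assumed. -/
theorem orderOf_frobenius (hq : residueCard M = residueCard F ^ Module.finrank F M)
    {σ : M ≃ₐ[F] M} (hσ : ActsAsPow σ (residueCard F)) :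
    orderOf σ = Module.finrank F M ∧ Nat.card (M ≃ₐ[F] M) = Module.finrank F M := by
  have h1 : Module.finrank F M ≤ orderOf σ := le_orderOf_frobenius hq hσ
  have h2 : Nat.card (M ≃ₐ[F] M) ≤ Module.finrank F M := by
    rw [Nat.card_eq_fintype_card]; exact AlgEquiv.card_le (F := F) (K := M)
  have h3 : orderOf σ ≤ Nat.card (M ≃ₐ[F] M) := orderOf_le_card
  exact ⟨le_antisymm (h3.trans h2) h1, le_antisymm h2 (h1.trans h3)⟩

theorem isGalois_of_frobenius (hq : residueCard M = residueCard F ^ Module.finrank F M)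
    {σ : M ≃ₐ[F] M} (hσ : ActsAsPow σ (residueCard F)) : IsGalois F M :=
  IsGalois.of_card_aut_eq_finrank F M (orderOf_frobenius hq hσ).2

theorem exists_eq_frobenius_pow (hq : residueCard M = residueCard F ^ Module.finrank F M)
    {σ : M ≃ₐ[F] M} (hσ : ActsAsPow σ (residueCard F)) (ρ : M ≃ₐ[F] M) :
    ∃ n < Module.finrank F M, σ ^ n = ρ := by
  obtain ⟨h1, h2⟩ := orderOf_frobenius hq hσ
  have htop : Subgroup.zpowers σ = ⊤ :=
    Subgroup.eq_top_of_card_eq _ (by rw [Nat.card_zpowers, h1, h2])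
  have hρ : ρ ∈ Subgroup.zpowers σ := htop ▸ Subgroup.mem_top ρ
  rw [← mem_powers_iff_mem_zpowers] at hρ
  obtain ⟨m, rfl⟩ := hρ
  exact ⟨m % orderOf σ, h1 ▸ Nat.mod_lt _ (orderOf_pos σ), pow_mod_orderOf σ m⟩

/-- An automorphism of an unramified extension that acts trivially on the residue field
is trivial. -/
theorem eq_one_of_actsAsPow_one (hq : residueCard M = residueCard F ^ Module.finrank F M)
    {σ : M ≃ₐ[F] M} (hσ : ActsAsPow σ (residueCard F)) {ρ : M ≃ₐ[F] M}
    (hρ : ∀ x, ‖x‖ ≤ 1 → red (ρ x) = red x) : ρ = 1 := by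
  obtain ⟨n, hn, rfl⟩ := exists_eq_frobenius_pow hq hσ ρ
  have h1 := one_lt_residueCard_of_pow hq
  rcases Nat.eq_zero_or_pos n with rfl | h0
  · exact pow_zero σ
  have h : ActsAsPow (id : M → M) (residueCard F ^ n) := fun x hx =>
    ⟨hx, by rw [← (hσ.iterate n x hx).2, ← AlgEquiv.coe_pow, hρ x hx, id]⟩
  have := h.eq_one (by positivity) (by rw [hq]; exact Nat.pow_lt_pow_right h1 hn)
  exact absurd this (Nat.one_lt_pow h0.ne' h1).ne'

theorem algebraMap_trace_eq_sum_frobenius (hq : residueCard M = residueCard F ^ Module.finrank F M)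
    {σ : M ≃ₐ[F] M} (hσ : ActsAsPow σ (residueCard F)) (x : M) :
    algebraMap F M (Algebra.trace F M x) =
      ∑ i ∈ Finset.range (Module.finrank F M), (σ ^ i) x := by
  have := isGalois_of_frobenius hq hσ
  rw [trace_eq_sum_automorphisms]
  symm
  refine Finset.sum_bij (fun i _ => σ ^ i) (fun _ _ => Finset.mem_univ _) ?_ ?_ fun _ _ => rfl
  · intro i hi i' hi' h
    rw [Finset.mem_range, ← (orderOf_frobenius hq hσ).1] at hi hi'
    exact pow_injOn_Iio_orderOf hi hi' h
  · intro ρ _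
    obtain ⟨n, hn, rfl⟩ := exists_eq_frobenius_pow hq hσ ρ
    exact ⟨n, Finset.mem_range.2 hn, rfl⟩

/-- The trace is a sum of conjugates that all have the norm of `x`. -/
theorem norm_trace_le (hnorm : ∀ a : F, ‖algebraMap F M a‖ = ‖a‖)
    (hq : residueCard M = residueCard F ^ Module.finrank F M)
    {σ : M ≃ₐ[F] M} (hσ : ActsAsPow σ (residueCard F)) (hiso : ∀ x, ‖σ x‖ = ‖x‖) (x : M) :
    ‖Algebra.trace F M x‖ ≤ ‖x‖ := by
  rw [← hnorm, algebraMap_trace_eq_sum_frobenius hq hσ]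
  refine IsUltrametricDist.norm_sum_le_of_forall_le_of_nonneg (norm_nonneg _) fun i _ => ?_
  rw [AlgEquiv.coe_pow]
  exact (norm_iterate hiso i x).le

/-- The trace of an unramified extension is surjective on integers. -/
theorem exists_norm_trace_eq_one (hnorm : ∀ a : F, ‖algebraMap F M a‖ = ‖a‖)
    (hq : residueCard M = residueCard F ^ Module.finrank F M)
    {σ : M ≃ₐ[F] M} (hσ : ActsAsPow σ (residueCard F)) (hiso : ∀ x, ‖σ x‖ = ‖x‖) :
    ∃ y : M, ‖y‖ = 1 ∧ ‖Algebra.trace F M y‖ = 1 := by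
  set s := Module.finrank F M with hs
  have hs0 : 0 < s := Module.finrank_pos
  have h1 := one_lt_residueCard_of_pow hq
  obtain ⟨t, ht⟩ : ∃ t, s = t + 1 := ⟨s - 1, by omega⟩
  -- `P` induces the trace on residue classes. Its degree `q ^ (s - 1)` is less than the `q ^ s`
  -- elements of the residue field, so it does not vanish identically.
  set P : Polynomial (ResField M) := ∑ i ∈ Finset.range s, Polynomial.X ^ residueCard F ^ i with hP
  have hdeg : P.natDegree ≤ residueCard F ^ t := by
    refine Polynomial.natDegree_sum_le_of_forall_le _ _ fun i hi => ?_
    rw [Polynomial.natDegree_X_pow]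
    exact Nat.pow_le_pow_right (by omega) (by have := Finset.mem_range.1 hi; omega)
  have hP0 : P ≠ 0 := by
    intro h0
    have hc : P.coeff (residueCard F ^ t) = 1 := by
      rw [hP, Polynomial.finsetSum_coeff, Finset.sum_eq_single_of_mem t (Finset.mem_range.2 (by omega))]
      · rw [Polynomial.coeff_X_pow_self]
      · intro i _ hi
        rw [Polynomial.coeff_X_pow, if_neg]
        intro h
        exact hi (Nat.pow_right_injective h1 h).symm
    rw [h0, Polynomial.coeff_zero] at hc
    exact zero_ne_one hc
  obtain ⟨x, hx, hne⟩ := exists_eval_red_ne_zero hP0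
    (hdeg.trans_lt (by rw [hq]; exact Nat.pow_lt_pow_right h1 (by omega)))
  have hpow : ∀ i, ActsAsPow (σ ^ i : M ≃ₐ[F] M) (residueCard F ^ i) := fun i => by
    rw [AlgEquiv.coe_pow]; exact hσ.iterate i
  have hev : P.eval (red x) = red (algebraMap F M (Algebra.trace F M x)) := by
    rw [algebraMap_trace_eq_sum_frobenius hq hσ, red_sum _ fun i _ => (hpow i x hx).1, hP,
      Polynomial.eval_finsetSum]
    refine Finset.sum_congr rfl fun i _ => ?_
    rw [(hpow i x hx).2, Polynomial.eval_pow, Polynomial.eval_X]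
  have hle := norm_trace_le hnorm hq hσ hiso x
  have htr : ‖algebraMap F M (Algebra.trace F M x)‖ ≤ 1 := by rw [hnorm]; exact hle.trans hx
  rw [hev, Ne, red_eq_zero_iff htr, hnorm, not_lt] at hne
  exact ⟨x, le_antisymm hx (hne.trans hle), le_antisymm (hle.trans hx) hne⟩

end Frobenius

/-! ### Norms on vector spaces -/

section VNorm

variable {E : Type*} [NormedField E] {V : Type*} [AddCommGroup V] [Module E V] (N : VNorm E V)

theorem VNorm.map_smul (a : E) (v : V) : N (a • v) = ‖a‖ * N v := N.smul' a v

theorem VNorm.map_zero : N 0 = 0 := (N.eq_zero_iff 0).2 rfl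

theorem VNorm.map_neg (v : V) : N (-v) = N v := by
  rw [← neg_one_smul E v, N.map_smul, norm_neg, norm_one, one_mul]

theorem VNorm.add_le_max (v w : V) : N (v + w) ≤ max (N v) (N w) := N.add_le_max' v w

theorem VNorm.sub_le_max (v w : V) : N (v - w) ≤ max (N v) (N w) := by
  rw [sub_eq_add_neg, ← N.map_neg w]; exact N.add_le_max _ _

theorem VNorm.nonneg (v : V) : 0 ≤ N v := by
  have := N.sub_le_max v v
  rwa [sub_self, N.map_zero, max_self] at this

theorem VNorm.pos {v : V} (hv : v ≠ 0) : 0 < N v :=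
  lt_of_le_of_ne (N.nonneg v) fun h => hv ((N.eq_zero_iff v).1 h.symm)

theorem VNorm.sum_le {ι : Type*} (s : Finset ι) (f : ι → V) {B : ℝ} (hB : 0 ≤ B)
    (h : ∀ i ∈ s, N (f i) ≤ B) : N (∑ i ∈ s, f i) ≤ B := by
  classical
  induction s using Finset.induction_on with
  | empty => rw [Finset.sum_empty, N.map_zero]; exact hB
  | insert a s ha ih =>
    rw [Finset.sum_insert ha]
    exact (N.add_le_max _ _).trans (max_le (h a (Finset.mem_insert_self a s))
      (ih fun i hi => h i (Finset.mem_insert_of_mem hi)))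

theorem VNorm.ext_fun {N N' : VNorm E V} (h : ∀ v, N v = N' v) : N = N' := by
  cases N; cases N'
  congr
  exact funext h

/-- The restriction of a norm along an injective linear map. -/
def VNorm.comap {W : Type*} [AddCommGroup W] [Module E W] (N : VNorm E V) (f : W →ₗ[E] V)
    (hf : Function.Injective f) : VNorm E W where
  toFun w := N (f w)
  eq_zero_iff w := by rw [N.eq_zero_iff, map_eq_zero_iff f hf]
  smul' a w := by rw [_root_.map_smul, N.map_smul]
  add_le_max' v w := by rw [map_add]; exact N.add_le_max _ _

/-- A norm is bounded by any norm that has an orthonormal basis. -/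
theorem VNorm.exists_le_mul {M : Type*} [NormedAddCommGroup M] [Module E M] (N : VNorm E M)
    {n : ℕ} (β : Module.Basis (Fin n) E M) (hβ : ∀ x i, ‖β.repr x i‖ ≤ ‖x‖) :
    ∃ C : ℝ, 0 ≤ C ∧ ∀ x, N x ≤ C * ‖x‖ := by
  have hC : 0 ≤ ∑ i, N (β i) := Finset.sum_nonneg fun i _ => N.nonneg _
  refine ⟨∑ i, N (β i), hC, fun x => ?_⟩
  conv_lhs => rw [← β.sum_repr x]
  refine N.sum_le _ _ (mul_nonneg hC (norm_nonneg x)) fun i _ => ?_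
  rw [N.map_smul, mul_comm]
  exact mul_le_mul (Finset.single_le_sum (f := fun i => N (β i)) (fun i _ => N.nonneg _)
    (Finset.mem_univ i)) (hβ x i) (norm_nonneg _) hC

end VNorm

/-! ### Residual generation by the norm one group -/

section NormOne

variable {M : Type*} [NormedField M] [IsUltrametricDist M]

/-- If `η` acts by `x ↦ x ^ m` on the residue field of cardinality `> m`, the fixed field of the
involution `η` takes all the values of `M`. -/
theorem exists_fixed_norm_eq [Finite (ResField M)] {η : M ≃+* M} (hiso : ∀ x, ‖η x‖ = ‖x‖)
    (hinv : ∀ x, η (η x) = x) {m : ℕ} (hη : ActsAsPow η m) (hm : 1 < m)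
    (hlt : m < residueCard M) {ϖ : M} (hϖ : ϖ ≠ 0) : ∃ y, η y = y ∧ ‖y‖ = ‖ϖ‖ := by
  have hε : ‖η ϖ / ϖ‖ ≤ 1 := by rw [norm_div, hiso, div_self (norm_ne_zero_iff.2 hϖ)]
  -- `P` is the reduction of `(ϖ x + η (ϖ x)) / ϖ`. As `m > 1`, the coefficient of `X` stays 1
  -- whatever the other one is; a non-root of `P` gives a symmetrized element with the norm of `ϖ`.
  set P : Polynomial (ResField M) :=
    Polynomial.X + Polynomial.C (red (η ϖ / ϖ)) * Polynomial.X ^ m with hP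
  have hP0 : P ≠ 0 := by
    intro h0
    have hc : P.coeff 1 = 1 := by
      rw [hP, Polynomial.coeff_add, Polynomial.coeff_X_one, Polynomial.coeff_C_mul,
        Polynomial.coeff_X_pow, if_neg hm.ne, mul_zero, add_zero]
    rw [h0, Polynomial.coeff_zero] at hc
    exact zero_ne_one hc
  have hdeg : P.natDegree ≤ m := by
    refine (Polynomial.natDegree_add_le _ _).trans (max_le ?_ ?_)
    · exact Polynomial.natDegree_X_le.trans hm.le
    · exact Polynomial.natDegree_C_mul_X_pow_le _ _
  obtain ⟨x, hx, hne⟩ := exists_eval_red_ne_zero hP0 (hdeg.trans_lt hlt)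
  refine ⟨ϖ * x + η (ϖ * x), by rw [map_add, hinv, add_comm], ?_⟩
  have h1 : ϖ * x + η (ϖ * x) = ϖ * (x + η ϖ / ϖ * η x) := by
    rw [map_mul]; field_simp
  have hηx := (hη x hx).1
  have h2 : red (x + η ϖ / ϖ * η x) = P.eval (red x) := by
    rw [red_add hx (norm_mul_le_one hε hηx), red_mul hε hηx, (hη x hx).2, hP]
    simp
  have h3 : ‖x + η ϖ / ϖ * η x‖ ≤ 1 := norm_add_le_one hx (norm_mul_le_one hε hηx)
  rw [← h2, Ne, red_eq_zero_iff h3, not_lt] at hne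
  rw [h1, norm_mul, le_antisymm h3 hne, mul_one]

/-- A subring of a finite field `k` of `m ^ 2` elements that contains the `(m - 1)`-st powers
of all nonzero elements is `k`. -/
theorem subring_eq_top_of_pow_mem {k : Type*} [Field k] [Finite k] {m : ℕ} (hm : 1 < m)
    (hcard : Nat.card k = m ^ 2) (S : Subring k) (hS : ∀ x : k, x ≠ 0 → x ^ (m - 1) ∈ S) :
    S = ⊤ := by
  classical
  have := Fintype.ofFinite k
  have := Fintype.ofFinite S
  let : Field S := Fintype.fieldOfDomain S
  have hfr : Nat.card k = Nat.card S ^ Module.finrank S k := Module.natCard_eq_pow_finrank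
  -- Each fibre of `x ↦ x ^ (m - 1)` has at most `m - 1` elements, so the `m ^ 2 - 1` nonzero
  -- elements have at least `m + 1` images.
  have hSgt : m < Nat.card S := by
    have hle : (Finset.univ.erase (0 : k)).card ≤
        (m - 1) * ((Finset.univ.erase (0 : k)).image (· ^ (m - 1))).card := by
      refine Finset.card_le_mul_card_image _ _ fun c _ => ?_
      have hX : (Polynomial.X ^ (m - 1) - Polynomial.C c : Polynomial k) ≠ 0 :=
        Polynomial.X_pow_sub_C_ne_zero (by omega) c
      refine (Polynomial.card_le_degree_of_subset_roots (p := Polynomial.X ^ (m - 1) -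
        Polynomial.C c) (fun a ha => ?_)).trans (by rw [Polynomial.natDegree_X_pow_sub_C])
      rw [Finset.mem_val, Finset.mem_filter] at ha
      rw [Polynomial.mem_roots hX]
      simp [Polynomial.IsRoot, ha.2]
    have hsub : ((Finset.univ.erase (0 : k)).image (· ^ (m - 1))).card ≤ Nat.card S := by
      rw [← Set.ncard_coe_finset]
      refine (Set.ncard_le_ncard (t := (S : Set k)) (fun y hy => ?_) (Set.toFinite _)).trans
        (Nat.card_coe_set_eq (S : Set k)).ge
      obtain ⟨x, hx, rfl⟩ := Finset.mem_image.1 (Finset.mem_coe.1 hy)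
      exact hS x (Finset.ne_of_mem_erase hx)
    rw [Finset.card_erase_of_mem (Finset.mem_univ _), Finset.card_univ,
      ← Nat.card_eq_fintype_card, hcard] at hle
    obtain ⟨t, rfl⟩ : ∃ t, m = t + 1 := ⟨m - 1, by omega⟩
    have h2 : (t + 1) ^ 2 - 1 = t * (t + 2) := by
      rw [show (t + 1) ^ 2 = t * (t + 2) + 1 by ring]; rfl
    rw [h2, Nat.add_sub_cancel] at hle
    rw [Nat.add_sub_cancel] at hsub
    have := Nat.le_of_mul_le_mul_left hle (by omega)
    omega
  -- A degree of at least 2 would give `k` more than `m ^ 2` elements.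
  have h1 : Module.finrank S k = 1 := by
    have hpos : 0 < Module.finrank S k := Module.finrank_pos
    by_contra hne
    have h2 : m ^ 2 < Nat.card S ^ 2 := Nat.pow_lt_pow_left hSgt two_ne_zero
    have h3 : Nat.card S ^ 2 ≤ Nat.card S ^ Module.finrank S k :=
      Nat.pow_le_pow_right (by omega) (by omega)
    omega
  rw [h1, pow_one] at hfr
  rw [← SetLike.coe_set_eq, Subring.coe_top]
  refine Set.eq_of_subset_of_ncard_le (Set.subset_univ _) ?_
  rw [Set.ncard_univ, hfr]
  exact (Nat.card_coe_set_eq (S : Set k)).le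

variable {F : Type*} [NormedField F] [Algebra F M]

/-- Multiplications that do not increase a norm form a ring. -/
def contractions (N : VNorm F M) : Subring M where
  carrier := {a | ∀ x, N (a * x) ≤ N x}
  mul_mem' {a b} ha hb x := by rw [mul_assoc]; exact (ha _).trans (hb x)
  one_mem' x := by rw [one_mul]
  add_mem' {a b} ha hb x := by
    rw [add_mul]; exact (N.add_le_max _ _).trans (max_le (ha x) (hb x))
  zero_mem' x := by rw [zero_mul, N.map_zero]; exact N.nonneg x
  neg_mem' {a} ha x := by rw [neg_mul, N.map_neg]; exact ha x

/-- The reduction of the integral elements of a subring. -/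
def redSubring (R : Subring M) : Subring (ResField M) where
  carrier := {c | ∃ a ∈ R, ‖a‖ ≤ 1 ∧ red a = c}
  mul_mem' := by
    rintro _ _ ⟨a, ha, ha1, rfl⟩ ⟨b, hb, hb1, rfl⟩
    exact ⟨a * b, R.mul_mem ha hb, norm_mul_le_one ha1 hb1, red_mul ha1 hb1⟩
  one_mem' := ⟨1, R.one_mem, norm_one.le, red_one⟩
  add_mem' := by
    rintro _ _ ⟨a, ha, ha1, rfl⟩ ⟨b, hb, hb1, rfl⟩
    exact ⟨a + b, R.add_mem ha hb, norm_add_le_one ha1 hb1, red_add ha1 hb1⟩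
  zero_mem' := ⟨0, R.zero_mem, by simp, red_zero⟩
  neg_mem' := by
    rintro _ ⟨a, ha, ha1, rfl⟩
    refine ⟨-a, R.neg_mem ha, by rwa [norm_neg], ?_⟩
    rw [← zero_sub, red_sub (by simp) ha1, red_zero, zero_sub]

/-- A norm on an unramified quadratic-type extension that is invariant under the elements with
`t η(t) = 1` is a multiple of the absolute value. -/
theorem VNorm.eq_mul_of_normOne_invariant [Finite (ResField M)]
    (hnorm : ∀ a : F, ‖algebraMap F M a‖ = ‖a‖) {π : F} (hπ : IsUniformizer π)
    (hval : ∀ x : M, ∃ a : F, ‖x‖ = ‖a‖)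
    {η : M ≃+* M} (hiso : ∀ x, ‖η x‖ = ‖x‖)
    (hinv : ∀ x, η (η x) = x) {m : ℕ} (hη : ActsAsPow η m) (hm : 1 < m)
    (hcard : residueCard M = m ^ 2) (N : VNorm F M) {C : ℝ} (hC : ∀ x, N x ≤ C * ‖x‖)
    (hN : ∀ t, t * η t = 1 → ∀ x, N (t * x) = N x) (x : M) : N x = ‖x‖ * N 1 := by
  -- For a unit `x`, the element `t = η x / x` satisfies `t η(t) = 1` and reduces to the `(m -
  -- 1)`-st power of the class of `x`.
  have htop : redSubring (contractions N) = ⊤ := by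
    refine subring_eq_top_of_pow_mem hm hcard _ fun c hc => ?_
    obtain ⟨x, hx, rfl⟩ := exists_red_eq c
    have hx1 : ‖x‖ = 1 := by
      rw [Ne, red_eq_zero_iff hx, not_lt] at hc
      exact le_antisymm hx hc
    have hx0 : x ≠ 0 := norm_ne_zero_iff.1 (by rw [hx1]; exact one_ne_zero)
    have hη0 : η x ≠ 0 := (map_ne_zero η).2 hx0
    have ht1 : ‖η x / x‖ ≤ 1 := by rw [norm_div, hiso, hx1, div_one]
    refine ⟨η x / x, fun y => (hN _ ?_ y).le, ht1, ?_⟩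
    · rw [map_div₀, hinv]; field_simp
    · have h := red_mul ht1 hx
      rw [div_mul_cancel₀ _ hx0, (hη x hx).2] at h
      refine mul_right_cancel₀ hc ?_
      rw [← h, ← pow_succ, Nat.sub_add_cancel hm.le]
  have hsm : ∀ (a : F) (x : M), a • x = algebraMap F M a * x := fun a x => Algebra.smul_def a x
  have hdec : ∀ a : M, ‖a‖ ≤ 1 → ∃ r ∈ contractions N, ∃ a' : M, ‖a'‖ ≤ 1 ∧ a = r + π • a' := by
    intro a ha
    obtain ⟨r, hr, hr1, har⟩ : red a ∈ redSubring (contractions N) := htop ▸ Subring.mem_top _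
    have hlt := (red_eq_iff ha hr1).1 har.symm
    obtain ⟨d, hd⟩ := hval (a - r)
    have hπ0 : algebraMap F M π ≠ 0 := (map_ne_zero _).2 hπ.1
    refine ⟨r, hr, (algebraMap F M π)⁻¹ * (a - r), ?_, ?_⟩
    · rw [norm_mul, norm_inv, hnorm, hd, inv_mul_le_iff₀ hπ.norm_pos, mul_one]
      exact hπ.2.2 d (hd ▸ hlt)
    · rw [hsm, mul_inv_cancel_left₀ hπ0, add_sub_cancel]
  -- The crude bound by `C` starts the induction; splitting off one more contraction from `a`
  -- improves the second term by a factor `‖π‖`, so it vanishes in the limit.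
  have hbound : ∀ n : ℕ, ∀ a : M, ‖a‖ ≤ 1 → ∀ x, N (a * x) ≤ max (N x) (‖π‖ ^ n * (C * ‖x‖)) := by
    intro n
    induction n with
    | zero =>
      intro a ha x
      refine le_max_of_le_right ?_
      rw [pow_zero, one_mul]
      have hCx : 0 ≤ C * ‖x‖ := (N.nonneg x).trans (hC x)
      refine (hC _).trans ?_
      rw [norm_mul, mul_left_comm]
      exact mul_le_of_le_one_left hCx ha
    | succ n ih =>
      intro a ha x
      obtain ⟨r, hr, a', ha', rfl⟩ := hdec a ha
      rw [add_mul, smul_mul_assoc]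
      refine (N.add_le_max _ _).trans (max_le (le_max_of_le_left (hr x)) ?_)
      rw [N.map_smul]
      refine (mul_le_mul_of_nonneg_left (ih a' ha' x) (norm_nonneg π)).trans ?_
      rw [mul_max_of_nonneg _ _ (norm_nonneg π), pow_succ', mul_assoc]
      exact max_le_max (mul_le_of_le_one_left (N.nonneg x) hπ.2.1.le) le_rfl
  have hcontr : ∀ a : M, ‖a‖ ≤ 1 → ∀ x, N (a * x) ≤ N x := by
    intro a ha x
    by_contra! hlt
    have ht : Filter.Tendsto (fun n : ℕ => ‖π‖ ^ n * (C * ‖x‖)) Filter.atTop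
        (nhds (0 * (C * ‖x‖))) :=
      (tendsto_pow_atTop_nhds_zero_of_lt_one (norm_nonneg _) hπ.2.1).mul_const _
    rw [zero_mul] at ht
    obtain ⟨n, hn⟩ := (ht.eventually_lt_const ((N.nonneg x).trans_lt hlt)).exists
    exact absurd (hbound n a ha x) (not_le.2 (max_lt hlt hn))
  by_cases hx : x = 0
  · rw [hx, N.map_zero, norm_zero, zero_mul]
  obtain ⟨a, ha⟩ := hval x
  have ha0 : a ≠ 0 := by rintro rfl; exact hx (norm_eq_zero.1 (by simpa using ha))
  have ha0' : algebraMap F M a ≠ 0 := (map_ne_zero _).2 ha0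
  obtain ⟨u, hu⟩ : ∃ u, u = (algebraMap F M a)⁻¹ * x := ⟨_, rfl⟩
  have hxu : x = a • u := by rw [hu, hsm, mul_inv_cancel_left₀ ha0']
  have hu1 : ‖u‖ = 1 := by
    rw [hu, norm_mul, norm_inv, hnorm, ha, inv_mul_cancel₀ (norm_ne_zero_iff.2 ha0)]
  have hu0 : u ≠ 0 := norm_ne_zero_iff.1 (by rw [hu1]; exact one_ne_zero)
  -- Both the unit `u` and its inverse are contractions.
  have h1 : N u = N 1 := by
    refine le_antisymm ?_ ?_
    · simpa using hcontr u hu1.le 1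
    · simpa [hu0] using hcontr u⁻¹ (by rw [norm_inv, hu1, inv_one]) u
  rw [ha, hxu, N.map_smul, h1]

end NormOne

/-! ### Lattice norms -/

section Lattice

variable {E : Type*} [NormedField E] {V : Type*} [AddCommGroup V] [Module E V] {π : E}

theorem latticeNorm_bddBelow (Λ : Set V) (v : V) :
    BddBelow {t : ℝ | ∃ a : E, ∃ w ∈ Λ, v = a • w ∧ t = ‖a‖} :=
  ⟨0, by rintro _ ⟨a, _, _, _, rfl⟩; exact norm_nonneg a⟩

theorem latticeNorm_nonneg (Λ : Set V) (v : V) : 0 ≤ latticeNorm E Λ v :=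
  Real.sInf_nonneg (by rintro _ ⟨a, _, _, _, rfl⟩; exact norm_nonneg a)

theorem latticeNorm_le {Λ : Set V} {v w : V} {a : E} (hw : w ∈ Λ) (h : v = a • w) :
    latticeNorm E Λ v ≤ ‖a‖ := csInf_le (latticeNorm_bddBelow Λ v) ⟨a, w, hw, h, rfl⟩

theorem IsLattice.exists_smul (hπ : IsUniformizer π) {Λ : Set V} (hΛ : IsLattice E Λ) (v : V) :
    ∃ a : E, ∃ w ∈ Λ, v = a • w := by
  obtain ⟨n, e, rfl⟩ := hΛ
  obtain ⟨N, hN⟩ := (tendsto_pow_atTop_nhds_zero_of_lt_one (norm_nonneg _) hπ.2.1).mul_const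
    (∑ i, ‖e.repr v i‖) |>.eventually_lt_const (by rw [zero_mul]; exact one_pos) |>.exists
  refine ⟨(π ^ N)⁻¹, π ^ N • v, fun i => ?_, (inv_smul_smul₀ (pow_ne_zero N hπ.1) v).symm⟩
  rw [map_smul, Finsupp.smul_apply, smul_eq_mul, norm_mul, norm_pow]
  refine le_trans ?_ hN.le
  gcongr
  exact Finset.single_le_sum (f := fun i => ‖e.repr v i‖) (fun i _ => norm_nonneg _)
    (Finset.mem_univ i)

theorem IsLattice.smul_mem {Λ : Set V} (hΛ : IsLattice E Λ) {a : E} (ha : ‖a‖ ≤ 1) {w : V}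
    (hw : w ∈ Λ) : a • w ∈ Λ := by
  obtain ⟨n, e, rfl⟩ := hΛ
  intro i
  rw [map_smul, Finsupp.smul_apply, smul_eq_mul, norm_mul]
  exact mul_le_one₀ ha (norm_nonneg _) (hw i)

/-- If `v = a • w` with `w` in `Λ'` and `‖a‖ ≤ 1`, then `v` would lie in `Λ`. So `‖a‖ > 1`, and
discreteness improves this to `‖π‖⁻¹`. The case of interest is that `Λ'` is the dual lattice. -/
theorem IsLattice.inv_le_latticeNorm (hπ : IsUniformizer π) {Λ Λ' : Set V} (hΛ : IsLattice E Λ)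
    (hsub : Λ' ⊆ Λ) {v : V} (hne : ∃ a : E, ∃ w ∈ Λ', v = a • w) (hv : v ∉ Λ) :
    ‖π‖⁻¹ ≤ latticeNorm E Λ' v := by
  obtain ⟨a, w, hw, h⟩ := hne
  refine le_csInf ⟨‖a‖, a, w, hw, h, rfl⟩ ?_
  rintro _ ⟨a, w, hw, rfl, rfl⟩
  have ha : 1 < ‖a‖ := by
    by_contra! ha
    exact hv (hΛ.smul_mem ha (hsub hw))
  have ha0 : 0 < ‖a‖ := one_pos.trans ha
  have := hπ.2.2 a⁻¹ (by rw [norm_inv]; exact inv_lt_one_of_one_lt₀ ha)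
  rw [norm_inv] at this
  exact (inv_le_comm₀ ha0 hπ.norm_pos).1 this

/-- An almost self-dual lattice is a ball for the norm of its vertex. -/
theorem IsAlmostSelfDual.mem_iff (hπ : IsUniformizer π) {φ : V → V → E} {Λ : Set V}
    (hΛ : IsAlmostSelfDual φ π Λ) (v : V) :
    v ∈ Λ ↔ Real.sqrt (latticeNorm E Λ v * latticeNorm E (dualLattice φ Λ) v) ≤
      Real.sqrt ‖π‖⁻¹ := by
  have hpos : 0 < ‖π‖⁻¹ := inv_pos.2 hπ.norm_pos
  have hne : ∀ v, ∃ a : E, ∃ w ∈ dualLattice φ Λ, v = a • w := fun v => by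
    obtain ⟨a, w, hw, rfl⟩ := hΛ.1.exists_smul hπ v
    exact ⟨a * π⁻¹, π • w, hΛ.2.2 w hw, by rw [mul_smul, inv_smul_smul₀ hπ.1]⟩
  -- On `Λ` the two lattice norms are at most `1` and `‖π‖⁻¹`; off `Λ` both are at least `‖π‖⁻¹`, so
  -- their product exceeds `‖π‖⁻¹`.
  constructor
  · intro hv
    refine Real.sqrt_le_sqrt ?_
    have h1 : latticeNorm E Λ v ≤ 1 := by
      simpa using latticeNorm_le (E := E) hv (one_smul E v).symm
    have h2 : latticeNorm E (dualLattice φ Λ) v ≤ ‖π‖⁻¹ := by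
      rw [← norm_inv]
      exact latticeNorm_le (hΛ.2.2 v hv) (inv_smul_smul₀ hπ.1 v).symm
    simpa using mul_le_mul h1 h2 (latticeNorm_nonneg _ v) zero_le_one
  · intro h
    by_contra hv
    rw [Real.sqrt_le_sqrt_iff hpos.le] at h
    have h1 := hΛ.1.inv_le_latticeNorm hπ subset_rfl (hΛ.1.exists_smul hπ v) hv
    have h2 := hΛ.1.inv_le_latticeNorm hπ hΛ.2.1 (hne v) hv
    have h3 := (mul_le_mul h1 h2 hpos.le (latticeNorm_nonneg _ v)).trans h
    have h4 : 1 < ‖π‖⁻¹ := (one_lt_inv₀ hπ.norm_pos).2 hπ.2.1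
    have h5 : ‖π‖⁻¹ < ‖π‖⁻¹ * ‖π‖⁻¹ := lt_mul_of_one_lt_left hpos h4
    linarith

end Lattice

/-! ### Split norms on products -/

section MaxNorm

variable {ι : Type*} {M : ι → Type*} [∀ i, NormedField (M i)]

/-- The maximum norm with weights `c`. -/
def maxNorm (c : ι → ℝ) (v : ∀ i, M i) : ℝ := ⨆ i, c i * ‖v i‖

theorem maxNorm_le {c : ι → ℝ} {v : ∀ i, M i} {B : ℝ} (hB : 0 ≤ B) (h : ∀ i, c i * ‖v i‖ ≤ B) :
    maxNorm c v ≤ B := Real.iSup_le h hB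

theorem maxNorm_zero (c : ι → ℝ) : maxNorm c (0 : ∀ i, M i) = 0 := by
  simp [maxNorm]

theorem maxNorm_nonneg {c : ι → ℝ} (hc : ∀ i, 0 < c i) (v : ∀ i, M i) : 0 ≤ maxNorm c v :=
  Real.iSup_nonneg fun i => mul_nonneg (hc i).le (norm_nonneg _)

variable [Fintype ι]

theorem le_maxNorm (c : ι → ℝ) (v : ∀ i, M i) (i : ι) : c i * ‖v i‖ ≤ maxNorm c v :=
  le_ciSup (f := fun i => c i * ‖v i‖) (Set.finite_range _).bddAbove i

theorem exists_maxNorm_eq {c : ι → ℝ} (hc : ∀ i, 0 < c i) {v : ∀ i, M i} (hv : v ≠ 0) :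
    ∃ i, v i ≠ 0 ∧ maxNorm c v = c i * ‖v i‖ := by
  obtain ⟨k, hk⟩ := Function.ne_iff.1 hv
  obtain ⟨i, -, hi⟩ := Finset.exists_max_image Finset.univ (fun i => c i * ‖v i‖)
    ⟨k, Finset.mem_univ k⟩
  have h1 : 0 < c k * ‖v k‖ := mul_pos (hc k) (norm_pos_iff.2 hk)
  refine ⟨i, fun h0 => ?_, le_antisymm (maxNorm_le (mul_nonneg (hc i).le (norm_nonneg _))
    fun k => hi k (Finset.mem_univ k)) (le_maxNorm c v i)⟩
  have := h1.trans_le (hi k (Finset.mem_univ k))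
  simp [h0] at this

theorem maxNorm_single [DecidableEq ι] {c : ι → ℝ} (hc : ∀ i, 0 < c i) (i : ι) (x : M i) :
    maxNorm c (Pi.single i x) = c i * ‖x‖ := by
  refine le_antisymm (maxNorm_le (mul_nonneg (hc i).le (norm_nonneg _)) fun k => ?_) ?_
  · by_cases h : k = i
    · subst h; rw [Pi.single_eq_same]
    · rw [Pi.single_eq_of_ne h, norm_zero, mul_zero]
      exact mul_nonneg (hc i).le (norm_nonneg _)
  · simpa using le_maxNorm c (Pi.single i x) i

variable {E : Type*} [NormedField E]

/-- The geometric mean of two maximum norms whose weights differ at most by one step. -/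
theorem sqrt_maxNorm_mul_maxNorm {π : E} (hπ : IsUniformizer π)
    (hval : ∀ i (x : M i), ∃ a : E, ‖x‖ = ‖a‖) {b b' : ι → ℤ} (h1 : ∀ i, b i ≤ b' i)
    (h2 : ∀ i, b' i ≤ b i + 1) (v : ∀ i, M i) :
    Real.sqrt (maxNorm (fun i => ‖π‖ ^ (-b i)) v * maxNorm (fun i => ‖π‖ ^ (-b' i)) v) =
      maxNorm (fun i => Real.sqrt (‖π‖ ^ (-b i - b' i))) v := by
  by_cases hv : v = 0
  · simp [hv, maxNorm_zero]
  have h0 : 0 < ‖π‖ := hπ.norm_pos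
  have hb : ∀ i, 0 < ‖π‖ ^ (-b i) := fun i => zpow_pos h0 _
  have hb' : ∀ i, 0 < ‖π‖ ^ (-b' i) := fun i => zpow_pos h0 _
  have hterm : ∀ i, Real.sqrt (‖π‖ ^ (-b i - b' i)) * ‖v i‖ =
      Real.sqrt ((‖π‖ ^ (-b i) * ‖v i‖) * (‖π‖ ^ (-b' i) * ‖v i‖)) := fun i => by
    rw [mul_mul_mul_comm, Real.sqrt_mul (by positivity), Real.sqrt_mul_self (norm_nonneg _),
      ← zpow_add₀ h0.ne', sub_eq_add_neg]
  have hn : ∀ i, v i ≠ 0 → ∃ n : ℤ, ‖v i‖ = ‖π‖ ^ n := fun i hi => by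
    obtain ⟨a, ha⟩ := hval i (v i)
    rw [ha]
    exact hπ.exists_norm_eq_zpow (norm_pos_iff.1 (ha ▸ norm_pos_iff.2 hi))
  -- The geometric mean of two maxima is the maximum of the geometric means once both are attained
  -- at a common index.
  suffices h : ∃ i, maxNorm (fun i => ‖π‖ ^ (-b i)) v = ‖π‖ ^ (-b i) * ‖v i‖ ∧
      maxNorm (fun i => ‖π‖ ^ (-b' i)) v = ‖π‖ ^ (-b' i) * ‖v i‖ by
    obtain ⟨i, hi, hi'⟩ := h
    refine le_antisymm ?_ (maxNorm_le (Real.sqrt_nonneg _) fun k => ?_)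
    · rw [hi, hi', ← hterm i]
      exact le_maxNorm (fun i => Real.sqrt (‖π‖ ^ (-b i - b' i))) v i
    · rw [hterm]
      exact Real.sqrt_le_sqrt (mul_le_mul (le_maxNorm (fun i => ‖π‖ ^ (-b i)) v k)
        (le_maxNorm (fun i => ‖π‖ ^ (-b' i)) v k) (by positivity) (maxNorm_nonneg hb v))
  obtain ⟨i, hi0, hi⟩ := exists_maxNorm_eq hb hv
  obtain ⟨k, hk0, hk⟩ := exists_maxNorm_eq hb' hv
  obtain ⟨n, hn_i⟩ := hn i hi0
  obtain ⟨l, hn_k⟩ := hn k hk0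
  have e1 := le_maxNorm (fun i => ‖π‖ ^ (-b i)) v k
  have e2 := le_maxNorm (fun i => ‖π‖ ^ (-b' i)) v i
  rw [hi, hn_i, hn_k, ← zpow_add₀ h0.ne', ← zpow_add₀ h0.ne', hπ.zpow_le_zpow_iff] at e1
  rw [hk, hn_i, hn_k, ← zpow_add₀ h0.ne', ← zpow_add₀ h0.ne', hπ.zpow_le_zpow_iff] at e2
  have := h1 i; have := h2 i; have := h1 k; have := h2 k
  -- Either the second maximizer `k` also serves the first norm, or `i` wins there by a full integer
  -- step; since the weights shift by at most one step, `i` then ties with `k` for the second norm.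
  by_cases hc : -b k + l = -b i + n
  · refine ⟨k, ?_, hk⟩
    rw [hi, hn_i, hn_k, ← zpow_add₀ h0.ne', ← zpow_add₀ h0.ne', hc]
  · refine ⟨i, hi, ?_⟩
    rw [hk, hn_i, hn_k, ← zpow_add₀ h0.ne', ← zpow_add₀ h0.ne', hπ.zpow_inj]
    omega

variable [∀ i, Algebra E (M i)] [∀ i, IsUltrametricDist (M i)]

/-- The maximum norm with weights `c`, as a norm on the product. -/
def maxVNorm (hnorm : ∀ i (a : E), ‖algebraMap E (M i) a‖ = ‖a‖) (c : ι → ℝ) (hc : ∀ i, 0 < c i) :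
    VNorm E (∀ i, M i) where
  toFun := maxNorm c
  eq_zero_iff v := by
    refine ⟨fun h => ?_, fun h => h ▸ maxNorm_zero c⟩
    by_contra hv
    obtain ⟨i, hi, h'⟩ := exists_maxNorm_eq hc hv
    exact (mul_pos (hc i) (norm_pos_iff.2 hi)).ne' (h'.symm.trans h)
  smul' a v := by
    rw [maxNorm, maxNorm, Real.mul_iSup_of_nonneg (norm_nonneg a)]
    refine iSup_congr fun i => ?_
    rw [Pi.smul_apply, Algebra.smul_def, norm_mul, hnorm]
    ring
  add_le_max' v w := by
    refine maxNorm_le (le_max_of_le_left (maxNorm_nonneg hc v)) fun i => ?_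
    refine (mul_le_mul_of_nonneg_left (IsUltrametricDist.norm_add_le_max _ _) (hc i).le).trans ?_
    rw [mul_max_of_nonneg _ _ (hc i).le]
    exact max_le_max (le_maxNorm c v i) (le_maxNorm c w i)

theorem maxVNorm_apply (hnorm : ∀ i (a : E), ‖algebraMap E (M i) a‖ = ‖a‖) (c : ι → ℝ)
    (hc : ∀ i, 0 < c i) (v : ∀ i, M i) : maxVNorm hnorm c hc v = maxNorm c v := rfl

end MaxNorm

/-! ### Orthogonal sums of forms -/

section Form

set_option linter.unusedSectionVars false

variable {ι : Type*} [Fintype ι] {M : ι → Type*} [∀ i, NormedField (M i)]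
  {E : Type*} [NormedField E] [∀ i, Algebra E (M i)]

/-- The box of radii `‖π‖ ^ b i`. -/
def box (M : ι → Type*) [∀ i, NormedField (M i)] (π : E) (b : ι → ℤ) : Set (∀ i, M i) :=
  {v | ∀ i, ‖v i‖ ≤ ‖π‖ ^ b i}

/-- The form `φ` is an orthogonal sum of forms on lines over the factors `M i`, with the `i`-th one
bounded by `m i`, and attaining this bound. -/
structure IsSplitForm [DecidableEq ι] (φ : (∀ i, M i) → (∀ i, M i) → E) (m : ι → ℝ) : Prop where
  norm_le : ∀ v w, ∀ B : ℝ, 0 ≤ B → (∀ i, m i * ‖v i‖ * ‖w i‖ ≤ B) → ‖φ v w‖ ≤ B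
  attained : ∀ v i, v i ≠ 0 → ∀ a : E, ∃ y : M i, ‖y‖ = ‖a‖ ∧
    ‖φ v (Pi.single i y)‖ = m i * ‖v i‖ * ‖y‖

variable {φ : (∀ i, M i) → (∀ i, M i) → E} {m : ι → ℝ}

/-- Factoring `m ‖v‖ ‖w‖` as `(m / c ‖v‖)(c ‖w‖)` gives the upper bound; vectors supported in one
coordinate, on which the form attains its bound, give the lower one. -/
theorem dualNorm_maxVNorm [DecidableEq ι] [∀ i, IsUltrametricDist (M i)] (hφ : IsSplitForm φ m)
    (hm : ∀ i, 0 < m i) (hnorm : ∀ i (a : E), ‖algebraMap E (M i) a‖ = ‖a‖) (c : ι → ℝ)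
    (hc : ∀ i, 0 < c i) (v : ∀ i, M i) :
    dualNorm φ (maxVNorm hnorm c hc) v = maxNorm (fun i => m i / c i) v := by
  have hmc : ∀ i, 0 < m i / c i := fun i => div_pos (hm i) (hc i)
  have hle : ∀ w, ‖φ v w‖ / maxVNorm hnorm c hc w ≤ maxNorm (fun i => m i / c i) v := by
    intro w
    refine div_le_of_le_mul₀ (maxNorm_nonneg hc w) (maxNorm_nonneg hmc v) ?_
    refine hφ.norm_le v w _ (mul_nonneg (maxNorm_nonneg hmc v) (maxNorm_nonneg hc w)) fun i => ?_
    calc m i * ‖v i‖ * ‖w i‖ = (m i / c i * ‖v i‖) * (c i * ‖w i‖) := by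
          field_simp [(hc i).ne']
      _ ≤ _ := mul_le_mul (le_maxNorm (fun i => m i / c i) v i) (le_maxNorm c w i)
          (mul_nonneg (hc i).le (norm_nonneg _)) (maxNorm_nonneg hmc v)
  have hbdd : BddAbove (Set.range fun w => ‖φ v w‖ / maxVNorm hnorm c hc w) :=
    ⟨_, by rintro _ ⟨w, rfl⟩; exact hle w⟩
  refine le_antisymm (Real.iSup_le hle (maxNorm_nonneg hmc v)) (maxNorm_le ?_ fun i => ?_)
  · exact Real.iSup_nonneg fun w => div_nonneg (norm_nonneg _) (maxNorm_nonneg hc w)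
  · by_cases hi : v i = 0
    · rw [hi, norm_zero, mul_zero]
      exact Real.iSup_nonneg fun w => div_nonneg (norm_nonneg _) (maxNorm_nonneg hc w)
    obtain ⟨y, hy, h⟩ := hφ.attained v i hi 1
    rw [norm_one] at hy
    refine le_trans (le_of_eq ?_) (le_ciSup hbdd (Pi.single i y))
    simp only [maxVNorm_apply]
    rw [maxNorm_single hc, h, hy, mul_one, mul_one]
    ring

/-- The test vectors are supported in one coordinate and have the largest norm that the box allows,
which is why `attained` prescribes the norm of `y`. -/
theorem dualLattice_box [DecidableEq ι] {π : E} (hπ : IsUniformizer π) {e : ι → ℤ}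
    (hφ : IsSplitForm φ fun i => ‖π‖ ^ e i) (b : ι → ℤ) :
    dualLattice φ (box M π b) = box M π fun i => -e i - b i := by
  have h0 : 0 < ‖π‖ := hπ.norm_pos
  have hiff : ∀ i (x : M i), ‖x‖ ≤ ‖π‖ ^ (-e i - b i) ↔ ‖π‖ ^ e i * ‖x‖ * ‖π‖ ^ b i ≤ 1 := by
    intro i x
    rw [mul_comm, ← mul_assoc, ← zpow_add₀ h0.ne', ← le_inv_mul_iff₀ (zpow_pos h0 _), ← zpow_neg,
      mul_one, neg_add, add_comm, sub_eq_add_neg]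
  ext v
  constructor
  · intro hv i
    by_cases hi : v i = 0
    · rw [hi, norm_zero]; positivity
    obtain ⟨y, hy, h⟩ := hφ.attained v i hi (π ^ b i)
    rw [norm_zpow] at hy
    rw [hiff, ← hy, ← h]
    refine hv _ fun k => ?_
    by_cases hk : k = i
    · subst hk; rw [Pi.single_eq_same, hy]
    · rw [Pi.single_eq_of_ne hk, norm_zero]; positivity
  · intro hv w hw
    refine hφ.norm_le v w 1 zero_le_one fun i => ?_
    refine le_trans ?_ ((hiff i (v i)).1 (hv i))
    gcongr
    exact hw i

/-- The infimum is attained because the maximum norm takes its values in the value group of `E`. -/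
theorem latticeNorm_box {π : E} (hπ : IsUniformizer π)
    (hnorm : ∀ i (a : E), ‖algebraMap E (M i) a‖ = ‖a‖)
    (hval : ∀ i (x : M i), ∃ a : E, ‖x‖ = ‖a‖) (b : ι → ℤ) (v : ∀ i, M i) :
    latticeNorm E (box M π b) v = maxNorm (fun i => ‖π‖ ^ (-b i)) v := by
  have h0 : 0 < ‖π‖ := hπ.norm_pos
  have hb : ∀ i, 0 < ‖π‖ ^ (-b i) := fun i => zpow_pos h0 _
  have hsm : ∀ (a : E) (w : ∀ i, M i) i, ‖(a • w) i‖ = ‖a‖ * ‖w i‖ := fun a w i => by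
    rw [Pi.smul_apply, Algebra.smul_def, norm_mul, hnorm]
  have hle : ∃ a : E, ‖a‖ = maxNorm (fun i => ‖π‖ ^ (-b i)) v ∧ ∃ w ∈ box M π b, v = a • w := by
    by_cases hv : v = 0
    · exact ⟨0, by rw [norm_zero, hv, maxNorm_zero], 0, fun i => by
        rw [Pi.zero_apply, norm_zero]; positivity, by rw [hv, smul_zero]⟩
    obtain ⟨i, hi0, hi⟩ := exists_maxNorm_eq hb hv
    obtain ⟨a, ha⟩ := hval i (v i)
    have ha0 : a ≠ 0 := norm_pos_iff.1 (ha ▸ norm_pos_iff.2 hi0)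
    have hc0 : π ^ (-b i) * a ≠ 0 := mul_ne_zero (zpow_ne_zero _ hπ.1) ha0
    have hc : ‖π ^ (-b i) * a‖ = maxNorm (fun i => ‖π‖ ^ (-b i)) v := by
      rw [norm_mul, norm_zpow, hi, ha]
    refine ⟨π ^ (-b i) * a, hc, (π ^ (-b i) * a)⁻¹ • v, fun k => ?_, (smul_inv_smul₀ hc0 v).symm⟩
    rw [hsm, norm_inv, inv_mul_le_iff₀ (norm_pos_iff.2 hc0), hc, ← div_le_iff₀ (zpow_pos h0 _),
      div_eq_inv_mul, ← zpow_neg]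
    exact le_maxNorm (fun i => ‖π‖ ^ (-b i)) v k
  obtain ⟨a, ha, w, hw, hvw⟩ := hle
  refine le_antisymm (ha ▸ latticeNorm_le hw hvw) (le_csInf ⟨‖a‖, a, w, hw, hvw, rfl⟩ ?_)
  rintro _ ⟨a, w, hw, rfl, rfl⟩
  refine maxNorm_le (norm_nonneg a) fun i => ?_
  rw [hsm, mul_left_comm]
  refine mul_le_of_le_one_right (norm_nonneg a) ?_
  rw [zpow_neg, inv_mul_le_iff₀ (zpow_pos h0 _), mul_one]
  exact hw i

/-- The orthonormal bases of the factors, rescaled by `π ^ b i`, together form a basis of the box.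
-/
theorem isLattice_box {π : E} (hπ : IsUniformizer π) [IsUltrametricDist E]
    [∀ i, IsUltrametricDist (M i)]
    (hnorm : ∀ i (a : E), ‖algebraMap E (M i) a‖ = ‖a‖) {n : ι → ℕ}
    (β : ∀ i, Module.Basis (Fin (n i)) E (M i)) (hβ1 : ∀ i k, ‖β i k‖ ≤ 1)
    (hβ : ∀ i x k, ‖(β i).repr x k‖ ≤ ‖x‖) (b : ι → ℤ) : IsLattice E (box M π b) := by
  classical
  let e₀ : Module.Basis (Σ i, Fin (n i)) E (∀ i, M i) := Pi.basis β
  let u : (Σ i, Fin (n i)) → Eˣ := fun k => Units.mk0 (π ^ b k.1) (zpow_ne_zero _ hπ.1)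
  let e₁ := e₀.unitsSMul u
  let f := Fintype.equivFin (Σ i, Fin (n i))
  refine ⟨_, e₁.reindex f, ?_⟩
  have h0 : 0 < ‖π‖ := hπ.norm_pos
  have hrepr : ∀ v i (k : Fin (n i)), ‖e₁.repr v ⟨i, k⟩‖ = (‖π‖ ^ b i)⁻¹ * ‖(β i).repr (v i) k‖ := by
    intro v i k
    rw [Module.Basis.repr_unitsSMul, Pi.basis_repr]
    simp [u, Units.smul_def, norm_zpow]
  ext v
  constructor
  · intro hv l
    rw [Module.Basis.repr_reindex_apply]
    obtain ⟨i, k⟩ := f.symm l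
    rw [hrepr, inv_mul_le_iff₀ (zpow_pos h0 _), mul_one]
    exact (hβ i (v i) k).trans (hv i)
  · intro hv i
    rw [← (β i).sum_repr (v i)]
    refine IsUltrametricDist.norm_sum_le_of_forall_le_of_nonneg (zpow_pos h0 _).le fun k _ => ?_
    have := hv (f ⟨i, k⟩)
    rw [Module.Basis.repr_reindex_apply, Equiv.symm_apply_apply, hrepr,
      inv_mul_le_iff₀ (zpow_pos h0 _), mul_one] at this
    rw [Algebra.smul_def, norm_mul, hnorm]
    exact (mul_le_of_le_one_right (norm_nonneg _) (hβ1 i k)).trans this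

end Form

/-! ### Fixed points of a torus acting on a product -/

section FixedPoints

set_option linter.unusedSectionVars false

variable {ι : Type*} [Fintype ι] [DecidableEq ι] {M : ι → Type*} [∀ i, NormedField (M i)]
  [∀ i, IsUltrametricDist (M i)]
  {E : Type*} [NormedField E] [∀ i, Algebra E (M i)]

/-- If `t` is `-1` in coordinate `i` and `1` elsewhere, then `v - t v` is twice the `i`-th component
of `v`. As `‖2‖ = 1`, invariance bounds the norm of each component by that of `v`, which splits the
norm; `hfix` then settles each factor. -/
theorem VNorm.eq_maxVNorm (hnorm : ∀ i (a : E), ‖algebraMap E (M i) a‖ = ‖a‖) (N : VNorm E (∀ i, M i))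
    (h2 : ‖(2 : E)‖ = 1) {T : Subgroup (∀ i, M i)ˣ}
    (hT : ∀ t ∈ T, ∀ v, N ((t : ∀ i, M i) * v) = N v)
    (hneg : ∀ i, ∃ t ∈ T, (t : ∀ i, M i) = 1 - Pi.single i 2)
    (hfix : ∀ i (N : VNorm E (M i)), (∀ t ∈ T, ∀ x, N ((t : ∀ i, M i) i * x) = N x) →
      ∀ x, N x = ‖x‖ * N 1) :
    ∃ (c : ι → ℝ) (hc : ∀ i, 0 < c i), N = maxVNorm hnorm c hc := by
  have hc : ∀ i, 0 < N (Pi.single i 1) := fun i =>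
    N.pos fun h => one_ne_zero (by simpa using congrFun h i : (1 : M i) = 0)
  have hsingle : ∀ i (x : M i), N (Pi.single i x) = N (Pi.single i 1) * ‖x‖ := by
    intro i x
    rw [mul_comm]
    refine hfix i (N.comap (LinearMap.single E M i) (Pi.single_injective i)) (fun t ht x => ?_) x
    have := hT t ht (Pi.single i x)
    rw [← Pi.single_mul_right] at this
    exact this
  have hle : ∀ v i, N (Pi.single i 1) * ‖v i‖ ≤ N v := by
    intro v i
    obtain ⟨t, ht, hti⟩ := hneg i
    have h := N.sub_le_max v ((t : ∀ i, M i) * v)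
    have h3 : v - (t : ∀ i, M i) * v = (2 : E) • Pi.single i (v i) := by
      rw [hti, sub_mul, one_mul, sub_sub_cancel, two_smul, ← Pi.single_mul_left, two_mul,
        Pi.single_add]
    rwa [hT t ht, max_self, h3, N.map_smul, h2, one_mul, hsingle] at h
  refine ⟨fun i => N (Pi.single i 1), hc, VNorm.ext_fun fun v => le_antisymm ?_
    (maxNorm_le (N.nonneg v) (hle v))⟩
  conv_lhs => rw [← Finset.univ_sum_single v]
  refine N.sum_le _ _ (maxNorm_nonneg hc v) fun i _ => ?_
  rw [hsingle]
  exact le_maxNorm (fun i => N (Pi.single i 1)) v i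

/-- A bounded group that multiplies a norm by constants preserves it. -/
theorem VNorm.invariant_of_mul (N : VNorm E (∀ i, M i)) {T : Subgroup (∀ i, M i)ˣ}
    (hiso : ∀ t ∈ T, ∀ i, ‖(t : ∀ i, M i) i‖ = 1) {n : ι → ℕ}
    (β : ∀ i, Module.Basis (Fin (n i)) E (M i)) (hβ : ∀ i x k, ‖(β i).repr x k‖ ≤ ‖x‖)
    (hT : ∀ t ∈ T, ∃ c : ℝ, 0 < c ∧ ∀ v, N ((t : ∀ i, M i) * v) = c * N v) :
    ∀ t ∈ T, ∀ v, N ((t : ∀ i, M i) * v) = N v := by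
  choose C hC0 hC using fun i => (N.comap (LinearMap.single E M i)
    (Pi.single_injective i)).exists_le_mul (β i) (hβ i)
  have hbound : ∀ v, N v ≤ ∑ i, C i * ‖v i‖ := by
    intro v
    have hnn : ∀ i, 0 ≤ C i * ‖v i‖ := fun i => mul_nonneg (hC0 i) (norm_nonneg _)
    conv_lhs => rw [← Finset.univ_sum_single v]
    refine N.sum_le _ _ (Finset.sum_nonneg fun i _ => hnn i) fun i _ => (hC i (v i)).trans ?_
    exact Finset.single_le_sum (f := fun i => C i * ‖v i‖) (fun i _ => hnn i) (Finset.mem_univ i)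
  have hle : ∀ t ∈ T, ∀ v, N ((t : ∀ i, M i) * v) ≤ N v := by
    intro t ht v
    by_cases hv : v = 0
    · rw [hv, mul_zero]
    obtain ⟨c, hc0, hc⟩ := hT t ht
    have hNv := N.pos hv
    rw [hc]
    refine mul_le_of_le_one_left hNv.le ?_
    by_contra! h1
    -- A factor `c > 1` would make the norms of `t ^ k v` unbounded, whereas `hbound` controls them
    -- through coordinates whose absolute values do not change.
    have hpow : ∀ k : ℕ, N (((t ^ k : (∀ i, M i)ˣ) : ∀ i, M i) * v) = c ^ k * N v := by
      intro k
      induction k with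
      | zero => simp
      | succ k ih => rw [pow_succ', Units.val_mul, mul_assoc, hc, ih, pow_succ', mul_assoc]
    obtain ⟨k, hk⟩ := pow_unbounded_of_one_lt ((∑ i, C i * ‖v i‖) / N v) h1
    rw [div_lt_iff₀ hNv, ← hpow] at hk
    refine absurd (hbound _) (not_le.2 (lt_of_eq_of_lt ?_ hk))
    refine Finset.sum_congr rfl fun i _ => ?_
    rw [Pi.mul_apply, norm_mul, hiso _ (T.pow_mem ht k), one_mul]
  intro t ht v
  refine le_antisymm (hle t ht v) ?_
  simpa using hle t⁻¹ (T.inv_mem ht) ((t : ∀ i, M i) * v)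

/-- The values of `M` are discrete, so a real radius can be rounded down to a power of `‖π‖`; this
turns balls of a maximum norm into boxes. -/
theorem exists_radius {π : E} (hπ : IsUniformizer π) {M : Type*} [NormedField M]
    (hval : ∀ x : M, ∃ a : E, ‖x‖ = ‖a‖) {c s : ℝ} (hc : 0 < c) (hs : 0 < s) :
    ∃ a : ℤ, ∀ x : M, c * ‖x‖ ≤ s ↔ ‖x‖ ≤ ‖π‖ ^ a := by
  have h0 := hπ.norm_pos
  obtain ⟨n, h1, h2⟩ := exists_mem_Ico_zpow (div_pos hs hc) ((one_lt_inv₀ h0).2 hπ.2.1)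
  refine ⟨-n, fun x => ?_⟩
  rw [mul_comm, ← le_div_iff₀ hc]
  rw [inv_zpow, ← zpow_neg] at h1 h2
  refine ⟨fun h => ?_, fun h => h.trans h1⟩
  by_cases hx : x = 0
  · rw [hx, norm_zero]; positivity
  obtain ⟨a, ha⟩ := hval x
  obtain ⟨l, hl⟩ := hπ.exists_norm_eq_zpow (norm_pos_iff.1 (ha ▸ norm_pos_iff.2 hx))
  have h3 := h.trans_lt h2
  rw [ha, hl, hπ.zpow_lt_zpow_iff] at h3
  rw [ha, hl, hπ.zpow_le_zpow_iff]
  omega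

theorem box_subset_box_iff {π : E} (hπ : IsUniformizer π)
    (hnorm : ∀ i (a : E), ‖algebraMap E (M i) a‖ = ‖a‖) {a b : ι → ℤ} :
    box M π a ⊆ box M π b ↔ ∀ i, b i ≤ a i := by
  constructor
  · intro h i
    have hx : (fun i => algebraMap E (M i) (π ^ a i)) ∈ box M π a := fun i => by
      rw [hnorm, norm_zpow]
    have := h hx i
    rwa [hnorm, norm_zpow, hπ.zpow_le_zpow_iff] at this
  · intro h v hv i
    exact (hv i).trans (hπ.zpow_le_zpow_iff.2 (h i))

theorem smul_mem_box_iff {π : E} (hπ : IsUniformizer π)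
    (hnorm : ∀ i (a : E), ‖algebraMap E (M i) a‖ = ‖a‖) {b : ι → ℤ} {v : ∀ i, M i} :
    π • v ∈ box M π b ↔ v ∈ box M π fun i => b i - 1 := by
  refine forall_congr' fun i => ?_
  rw [Pi.smul_apply, Algebra.smul_def, norm_mul, hnorm, zpow_sub_one₀ hπ.norm_pos.ne',
    ← div_eq_mul_inv, le_div_iff₀ hπ.norm_pos, mul_comm]

/-- A box is an almost self-dual lattice only for one choice of the radii. -/
theorem eq_of_isAlmostSelfDual_box {π : E} (hπ : IsUniformizer π)
    (hnorm : ∀ i (a : E), ‖algebraMap E (M i) a‖ = ‖a‖)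
    {φ : (∀ i, M i) → (∀ i, M i) → E} {e b : ι → ℤ} (hφ : IsSplitForm φ fun i => ‖π‖ ^ e i)
    (h : IsAlmostSelfDual φ π (box M π b)) : b = fun i => -e i / 2 := by
  obtain ⟨-, h1, h2⟩ := h
  rw [dualLattice_box hπ hφ] at h1 h2
  rw [box_subset_box_iff hπ hnorm] at h1
  have h3 : box M π b ⊆ box M π fun i => -e i - b i - 1 := fun v hv =>
    (smul_mem_box_iff hπ hnorm).1 (h2 v hv)
  rw [box_subset_box_iff hπ hnorm] at h3
  -- The two inclusions read `2 b ≤ -e ≤ 2 b + 1`, so `b` is `-e / 2` rounded down.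
  funext i
  have := h1 i; have := h3 i
  omega

theorem isAlmostSelfDual_box [IsUltrametricDist E] {π : E} (hπ : IsUniformizer π)
    (hnorm : ∀ i (a : E), ‖algebraMap E (M i) a‖ = ‖a‖)
    {φ : (∀ i, M i) → (∀ i, M i) → E} {e : ι → ℤ} (hφ : IsSplitForm φ fun i => ‖π‖ ^ e i)
    {n : ι → ℕ} (β : ∀ i, Module.Basis (Fin (n i)) E (M i)) (hβ1 : ∀ i k, ‖β i k‖ ≤ 1)
    (hβ : ∀ i x k, ‖(β i).repr x k‖ ≤ ‖x‖) :
    IsAlmostSelfDual φ π (box M π fun i => -e i / 2) := by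
  refine ⟨isLattice_box hπ hnorm β hβ1 hβ _, ?_, fun v hv => ?_⟩
  · rw [dualLattice_box hπ hφ, box_subset_box_iff hπ hnorm]
    intro i; omega
  · rw [dualLattice_box hπ hφ, smul_mem_box_iff hπ hnorm]
    exact (box_subset_box_iff hπ hnorm).2 (fun i => by omega) hv

/-- The exponents of the box and its dual add up to `-e i`, whatever the rounding, so the geometric
mean always has the self-dual weights `√(‖π‖ ^ e i)`. -/
theorem sqrt_latticeNorm_box {π : E} (hπ : IsUniformizer π)
    (hnorm : ∀ i (a : E), ‖algebraMap E (M i) a‖ = ‖a‖)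
    (hval : ∀ i (x : M i), ∃ a : E, ‖x‖ = ‖a‖)
    {φ : (∀ i, M i) → (∀ i, M i) → E} {e : ι → ℤ} (hφ : IsSplitForm φ fun i => ‖π‖ ^ e i)
    (v : ∀ i, M i) :
    Real.sqrt (latticeNorm E (box M π fun i => -e i / 2) v *
      latticeNorm E (dualLattice φ (box M π fun i => -e i / 2)) v) =
      maxNorm (fun i => Real.sqrt (‖π‖ ^ e i)) v := by
  rw [dualLattice_box hπ hφ, latticeNorm_box hπ hnorm hval, latticeNorm_box hπ hnorm hval,
    sqrt_maxNorm_mul_maxNorm hπ hval (fun i => by omega) (fun i => by omega)]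
  congr 1
  funext i
  congr 2
  ring

variable {π : E} (hπ : IsUniformizer π)
  (hnorm : ∀ i (a : E), ‖algebraMap E (M i) a‖ = ‖a‖)

theorem sqrt_weight_pos (hπ : IsUniformizer π) (e : ι → ℤ) (i : ι) :
    0 < Real.sqrt (‖π‖ ^ e i) := Real.sqrt_pos.2 (zpow_pos hπ.norm_pos _)

/-- The norm on the product that is its own dual. -/
def selfDualNorm (e : ι → ℤ) : VNorm E (∀ i, M i) :=
  maxVNorm hnorm (fun i => Real.sqrt (‖π‖ ^ e i)) (sqrt_weight_pos hπ e)

variable {φ : (∀ i, M i) → (∀ i, M i) → E} {e : ι → ℤ}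

theorem mk_selfDualNorm_mem (hφ : IsSplitForm φ fun i => ‖π‖ ^ e i) :
    BuildingGL.mk (selfDualNorm hπ hnorm e) ∈ buildingU φ := by
  refine ⟨_, rfl, 1, one_pos, fun v => ?_⟩
  rw [one_mul, selfDualNorm, dualNorm_maxVNorm hφ (fun i => zpow_pos hπ.norm_pos _),
    maxVNorm_apply]
  congr 1
  funext i
  exact Real.div_sqrt

/-- Evaluation at the coordinate vectors gives `m_i / c_i = r c_i`, so `√m_i = √r c_i` with the same
factor for all `i`. -/
theorem mk_eq_of_dualNorm (hφ : IsSplitForm φ fun i => ‖π‖ ^ e i) {c : ι → ℝ}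
    (hc : ∀ i, 0 < c i) {r : ℝ} (hr : 0 < r)
    (h : ∀ v, dualNorm φ (maxVNorm hnorm c hc) v = r * maxVNorm hnorm c hc v) :
    BuildingGL.mk (maxVNorm hnorm c hc) = BuildingGL.mk (selfDualNorm hπ hnorm e) := by
  refine Quotient.sound ⟨Real.sqrt r, Real.sqrt_pos.2 hr, fun v => ?_⟩
  have hci : ∀ i, Real.sqrt (‖π‖ ^ e i) = Real.sqrt r * c i := fun i => by
    have hp := zpow_pos hπ.norm_pos (e i)
    have := h (Pi.single i 1)
    rw [dualNorm_maxVNorm hφ (fun i => zpow_pos hπ.norm_pos _), maxVNorm_apply,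
      maxNorm_single (fun i => div_pos (zpow_pos hπ.norm_pos _) (hc i)), maxNorm_single hc,
      norm_one, mul_one, mul_one, div_eq_iff (hc i).ne'] at this
    rw [this, mul_assoc, Real.sqrt_mul hr.le, Real.sqrt_mul_self (hc i).le]
  rw [selfDualNorm, maxVNorm_apply, maxVNorm_apply, maxNorm, maxNorm,
    Real.mul_iSup_of_nonneg (Real.sqrt_nonneg r)]
  refine iSup_congr fun i => ?_
  rw [hci, mul_assoc]

/-- `Λ` is recovered as a ball of its vertex norm. For a maximum norm that ball is a box, and the
radii of an almost self-dual box are forced. -/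
theorem mk_eq_of_isAlmostSelfDual (hval : ∀ i (x : M i), ∃ a : E, ‖x‖ = ‖a‖)
    (hφ : IsSplitForm φ fun i => ‖π‖ ^ e i)
    {c : ι → ℝ} (hc : ∀ i, 0 < c i) {Λ : Set (∀ i, M i)} (hΛ : IsAlmostSelfDual φ π Λ)
    (h : ∀ v, maxVNorm hnorm c hc v =
      Real.sqrt (latticeNorm E Λ v * latticeNorm E (dualLattice φ Λ) v)) :
    maxVNorm hnorm c hc = selfDualNorm hπ hnorm e := by
  have hs : 0 < Real.sqrt ‖π‖⁻¹ := Real.sqrt_pos.2 (inv_pos.2 hπ.norm_pos)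
  choose a ha using fun i => exists_radius hπ (hval i) (hc i) hs
  have hbox : Λ = box M π a := by
    ext v
    rw [hΛ.mem_iff hπ, ← h, maxVNorm_apply]
    exact ⟨fun hv i => (ha i _).1 ((le_maxNorm c v i).trans hv),
      fun hv => maxNorm_le hs.le fun i => (ha i _).2 (hv i)⟩
  rw [hbox] at hΛ h
  have hab := eq_of_isAlmostSelfDual_box hπ hnorm hφ hΛ
  rw [hab] at h
  refine VNorm.ext_fun fun v => ?_
  rw [h, sqrt_latticeNorm_box hπ hnorm hval hφ]
  rfl

end FixedPoints

/-! ### The fields `E_s` -/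

section PadicFields

variable {p : ℕ} [Fact p.Prime] {K : IntermediateField ℚ_[p] (PadicAlgCl p)}

/-- A finite extension of a `p`-adic field is a proper metric space. -/
theorem properSpace_of_finiteDimensional [FiniteDimensional ℚ_[p] K]
    (F : IntermediateField K (PadicAlgCl p)) [FiniteDimensional K F] : ProperSpace F := by
  let W : Submodule ℚ_[p] (PadicAlgCl p) :=
    Subalgebra.toSubmodule (F.restrictScalars ℚ_[p]).toSubalgebra
  have h1 : FiniteDimensional ℚ_[p] F := Module.Finite.trans K F
  have h2 : FiniteDimensional ℚ_[p] W := h1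
  have h3 : ProperSpace W := FiniteDimensional.proper ℚ_[p] W
  exact h3

/-- `ρ` lifts to an automorphism of the algebraic closure, under which the spectral norm is
invariant. -/
theorem norm_algEquiv {E : IntermediateField K (PadicAlgCl p)}
    (F : IntermediateField E (PadicAlgCl p)) (ρ : F ≃ₐ[K] F) (x : F) : ‖ρ x‖ = ‖x‖ := by
  have h1 : Algebra.IsAlgebraic K (PadicAlgCl p) := Algebra.IsAlgebraic.tower_top (K := ℚ_[p]) K
  have h2 : IsAlgClosure K (PadicAlgCl p) := ⟨inferInstance, h1⟩
  have h3 : Normal K (PadicAlgCl p) := IsAlgClosure.normal K (PadicAlgCl p)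
  have h0 : IsScalarTower K F (PadicAlgCl p) := IsScalarTower.of_algebraMap_eq fun _ => rfl
  let ρ' : PadicAlgCl p ≃ₐ[ℚ_[p]] PadicAlgCl p := (ρ.liftNormal (PadicAlgCl p)).restrictScalars ℚ_[p]
  have h4 : ((ρ x : F) : PadicAlgCl p) = ρ' (x : PadicAlgCl p) :=
    (AlgEquiv.liftNormal_commutes ρ (PadicAlgCl p) x).symm
  have h5 := spectralNorm_eq_of_equiv ρ' (x : PadicAlgCl p)
  rw [← h4] at h5
  exact h5.symm

theorem norm_two_eq_one (hp : p ≠ 2) (E : IntermediateField K (PadicAlgCl p)) :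
    ‖(2 : E)‖ = 1 := by
  have h1 : ‖(2 : E)‖ = ‖(2 : PadicAlgCl p)‖ := rfl
  have h2 : (2 : PadicAlgCl p) = ((2 : ℚ_[p]) : PadicAlgCl p) :=
    (map_ofNat (algebraMap ℚ_[p] (PadicAlgCl p)) 2).symm
  rw [h1, h2, PadicAlgCl.norm_extends]
  have h3 : ¬ ‖((2 : ℕ) : ℚ_[p])‖ < 1 := by
    rw [Padic.norm_natCast_lt_one_iff]
    intro h
    exact hp ((Nat.prime_dvd_prime_iff_eq Fact.out Nat.prime_two).1 h)
  have h4 : ‖((2 : ℕ) : ℚ_[p])‖ ≤ 1 := by simpa using Padic.norm_int_le_one (p := p) 2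
  simpa using le_antisymm h4 (not_lt.1 h3)

variable {E : IntermediateField K (PadicAlgCl p)} {π : E}

/-- In a ramified quadratic extension, the norm of a uniformizer is not attained on `K`. -/
theorem norm_uniformizer_ne (hram : ¬ IsUnramified E) (hπ : IsUniformizer π) (y : K) :
    ‖y‖ ≠ ‖π‖ := by
  intro h
  refine hram fun x => ?_
  by_cases hx : x = 0
  · exact ⟨0, by rw [hx, norm_zero, norm_zero]⟩
  obtain ⟨n, hn⟩ := hπ.exists_norm_eq_zpow hx
  exact ⟨y ^ n, by rw [norm_zpow, h, hn]⟩

/-- `1` and `π` are independent over `K` because `‖π‖` is not a value of `K`; in degree 2 they form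
a basis. -/
theorem exists_eq_add_mul_uniformizer (hE : Module.finrank K E = 2) (hram : ¬ IsUnramified E)
    (hπ : IsUniformizer π) (x : E) : ∃ a b : K, x = algebraMap K E a + algebraMap K E b * π := by
  have hli : LinearIndependent K ![(1 : E), π] := by
    rw [LinearIndependent.pair_iff]
    intro a b h
    by_cases hb : b = 0
    · subst hb
      refine ⟨?_, rfl⟩
      rw [zero_smul, add_zero, Algebra.smul_def, mul_one] at h
      exact (map_eq_zero _).1 h
    · exfalso
      have hb' : algebraMap K E b ≠ 0 := (map_ne_zero _).2 hb
      rw [Algebra.smul_def, Algebra.smul_def, mul_one] at h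
      have h1 : π = algebraMap K E (-a / b) := by
        rw [map_div₀, map_neg, eq_div_iff hb']
        linear_combination h
      exact norm_uniformizer_ne hram hπ (-a / b) (congrArg norm h1).symm
  have htop := hli.span_eq_top_of_card_eq_finrank (by simp [hE])
  have hx : x ∈ Submodule.span K (Set.range ![(1 : E), π]) := htop ▸ Submodule.mem_top
  rw [Matrix.range_cons, Matrix.range_cons, Matrix.range_empty, Set.union_empty,
    Set.singleton_union, Submodule.mem_span_pair] at hx
  obtain ⟨a, b, rfl⟩ := hx
  exact ⟨a, b, by rw [Algebra.smul_def, Algebra.smul_def, mul_one]⟩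

/-- If the two terms had equal norm with `b ≠ 0`, then `‖π‖ = ‖a / b‖` would be a value of `F`,
hence of `K`. -/
theorem norm_add_mul_uniformizer (hram : ¬ IsUnramified E) (hπ : IsUniformizer π)
    {F : IntermediateField K (PadicAlgCl p)} (hF : IsUnramified F) (a b : F) :
    ‖(a : PadicAlgCl p) + b * (π : PadicAlgCl p)‖ =
      max ‖(a : PadicAlgCl p)‖ ‖(b : PadicAlgCl p) * (π : PadicAlgCl p)‖ := by
  by_cases hb : b = 0
  · simp [hb]
  refine IsUltrametricDist.norm_add_eq_max_of_norm_ne_norm fun h => ?_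
  obtain ⟨y, hy⟩ := hF (a / b)
  refine norm_uniformizer_ne hram hπ y ?_
  rw [← hy, norm_div]
  rw [norm_mul] at h
  exact (div_eq_iff (norm_ne_zero_iff.2 hb)).2 (h.trans (mul_comm _ _))

/-- `F + Fπ` contains `E` and `F`, and is closed under products since it contains `π ^ 2`. -/
theorem exists_eq_add_mul_of_mem_sup (hE : Module.finrank K E = 2) (hram : ¬ IsUnramified E)
    (hπ : IsUniformizer π) (F : IntermediateField K (PadicAlgCl p)) {x : PadicAlgCl p}
    (hx : x ∈ E ⊔ F) : ∃ a b : F, x = a + b * (π : PadicAlgCl p) := by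
  have hfd : FiniteDimensional K E := Module.finite_of_finrank_pos (by omega)
  have hx' : x ∈ (E ⊔ F).toSubalgebra := hx
  rw [IntermediateField.sup_toSubalgebra_of_isAlgebraic_left, Algebra.sup_def] at hx'
  have hEmem : ∀ e : E, ∃ a b : F, (e : PadicAlgCl p) = a + b * (π : PadicAlgCl p) := by
    intro e
    obtain ⟨a, b, h⟩ := exists_eq_add_mul_uniformizer hE hram hπ e
    exact ⟨algebraMap K F a, algebraMap K F b, congrArg (algebraMap E (PadicAlgCl p)) h⟩
  have hFmem : ∀ c : F, ∃ a b : F, (c : PadicAlgCl p) = a + b * (π : PadicAlgCl p) :=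
    fun c => ⟨c, 0, by simp⟩
  obtain ⟨c, d, hcd⟩ := hEmem (π ^ 2)
  have hcd' : (π : PadicAlgCl p) ^ 2 = c + d * (π : PadicAlgCl p) := hcd
  clear hx
  induction hx' using Algebra.adjoin_induction with
  | mem x h =>
    rcases h with h | h
    · exact hEmem ⟨x, h⟩
    · exact hFmem ⟨x, h⟩
  | algebraMap r => exact hFmem (algebraMap K F r)
  | add x y _ _ ihx ihy =>
    obtain ⟨a, b, rfl⟩ := ihx
    obtain ⟨a', b', rfl⟩ := ihy
    exact ⟨a + a', b + b', by push_cast; ring⟩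
  | mul x y _ _ ihx ihy =>
    obtain ⟨a, b, rfl⟩ := ihx
    obtain ⟨a', b', rfl⟩ := ihy
    refine ⟨a * a' + b * b' * c, a * b' + a' * b + b * b' * d, ?_⟩
    push_cast
    linear_combination (b : PadicAlgCl p) * b' * hcd'

end PadicFields

/-! ### One factor: degrees and residue fields, the involution `η`, and the norm of `π_L`. -/

namespace ElementaryDatum

variable {p : ℕ} [Fact p.Prime] {K : IntermediateField ℚ_[p] (PadicAlgCl p)}
  {E : IntermediateField K (PadicAlgCl p)} {π : E} (D : ElementaryDatum E)

theorem norm_algebraMap (a : E) : ‖algebraMap E D.Es a‖ = ‖a‖ := rfl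

theorem exists_eq_add_mul (hE : Module.finrank K E = 2) (hram : ¬ IsUnramified E)
    (hπ : IsUniformizer π) (x : D.Es) :
    ∃ a b : D.Ks, (x : PadicAlgCl p) = a + b * (π : PadicAlgCl p) :=
  exists_eq_add_mul_of_mem_sup hE hram hπ D.Ks x.2

theorem s_pos : 0 < D.s := by
  rcases D.s_eq with h | h
  · omega
  · exact h.1

theorem finiteDimensional_Ks : FiniteDimensional K D.Ks :=
  Module.finite_of_finrank_pos (by rw [D.finrank_Ks]; exact D.s_pos)

/-- The extension `E_s / E` has the same value group. -/
theorem exists_norm_eq (hE : Module.finrank K E = 2) (hram : ¬ IsUnramified E)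
    (hπ : IsUniformizer π) (x : D.Es) : ∃ a : E, ‖x‖ = ‖a‖ := by
  obtain ⟨a, b, h⟩ := D.exists_eq_add_mul hE hram hπ x
  have hx : ‖x‖ = ‖(x : PadicAlgCl p)‖ := rfl
  rw [hx, h, norm_add_mul_uniformizer hram hπ D.unramified]
  rcases max_choice ‖(a : PadicAlgCl p)‖ ‖(b : PadicAlgCl p) * (π : PadicAlgCl p)‖ with h' | h'
  · obtain ⟨y, hy⟩ := D.unramified a
    exact ⟨algebraMap K E y, h'.trans hy⟩
  · obtain ⟨y, hy⟩ := D.unramified b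
    refine ⟨algebraMap K E y * π, h'.trans ?_⟩
    rw [norm_mul, norm_mul]
    exact congrArg (· * ‖(π : PadicAlgCl p)‖) hy

/-- `(a, b) ↦ a + bπ` is a bijection from two copies of `K_s`; injectivity comes from the norm
formula. -/
theorem finrank_K_Es (hE : Module.finrank K E = 2) (hram : ¬ IsUnramified E)
    (hπ : IsUniformizer π) : Module.finrank K D.Es = 2 * D.s := by
  have := D.finiteDimensional_Ks
  let i : D.Ks →ₗ[K] D.Es :=
    { toFun := fun a => ⟨a, (le_sup_right : D.Ks ≤ E ⊔ D.Ks) a.2⟩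
      map_add' := fun _ _ => rfl
      map_smul' := fun _ _ => rfl }
  let f : (D.Ks × D.Ks) →ₗ[K] D.Es :=
    i.coprod ((LinearMap.mulRight K (algebraMap E D.Es π)).comp i)
  have hf : ∀ a b, (f (a, b) : PadicAlgCl p) = a + b * (π : PadicAlgCl p) := fun a b => rfl
  have hinj : Function.Injective f := by
    rw [injective_iff_map_eq_zero]
    rintro ⟨a, b⟩ h
    have h1 := norm_add_mul_uniformizer hram hπ D.unramified a b
    rw [← hf, h, ZeroMemClass.coe_zero, norm_zero] at h1
    have h2 : ‖(a : PadicAlgCl p)‖ ≤ 0 := h1 ▸ le_max_left _ _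
    have h3 : ‖(b : PadicAlgCl p) * (π : PadicAlgCl p)‖ ≤ 0 := h1 ▸ le_max_right _ _
    have hπ0 : (π : PadicAlgCl p) ≠ 0 := fun h => hπ.1 (Subtype.ext h)
    rw [norm_le_zero_iff] at h2 h3
    rw [mul_eq_zero, or_iff_left hπ0] at h3
    exact Prod.ext (Subtype.ext h2) (Subtype.ext h3)
  have hsurj : Function.Surjective f := fun x => by
    obtain ⟨a, b, h⟩ := D.exists_eq_add_mul hE hram hπ x
    exact ⟨(a, b), Subtype.ext ((hf a b).trans h.symm)⟩
  rw [← (LinearEquiv.ofBijective f ⟨hinj, hsurj⟩).finrank_eq, Module.finrank_prod, D.finrank_Ks,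
    two_mul]

theorem finrank_E_Es (hE : Module.finrank K E = 2) (hram : ¬ IsUnramified E)
    (hπ : IsUniformizer π) : Module.finrank E D.Es = D.s := by
  have h1 := D.finrank_K_Es hE hram hπ
  rw [← Module.finrank_mul_finrank K E D.Es, hE] at h1
  omega

theorem finiteDimensional_K_Es (hE : Module.finrank K E = 2) (hram : ¬ IsUnramified E)
    (hπ : IsUniformizer π) : FiniteDimensional K D.Es :=
  Module.finite_of_finrank_pos (by rw [D.finrank_K_Es hE hram hπ]; have := D.s_pos; omega)

theorem finiteDimensional_E_Es (hE : Module.finrank K E = 2) (hram : ¬ IsUnramified E)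
    (hπ : IsUniformizer π) : FiniteDimensional E D.Es :=
  Module.finite_of_finrank_pos (by rw [D.finrank_E_Es hE hram hπ]; exact D.s_pos)

theorem properSpace_Es [FiniteDimensional ℚ_[p] K] (hE : Module.finrank K E = 2) :
    ProperSpace D.Es := by
  have h1 := D.finiteDimensional_Ks
  have h2 : FiniteDimensional K E := Module.finite_of_finrank_pos (by omega)
  have h3 : ProperSpace (E ⊔ D.Ks : IntermediateField K (PadicAlgCl p)) :=
    properSpace_of_finiteDimensional _
  exact h3

theorem finite_resField_Es [FiniteDimensional ℚ_[p] K] (hE : Module.finrank K E = 2) :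
    Finite (ResField D.Es) := by
  have := D.properSpace_Es hE
  exact finite_resField

theorem completeSpace_E [FiniteDimensional ℚ_[p] K] (hE : Module.finrank K E = 2) :
    CompleteSpace E := by
  have h2 : FiniteDimensional K E := Module.finite_of_finrank_pos (by omega)
  have := properSpace_of_finiteDimensional E
  infer_instance

theorem residueCard_Es [FiniteDimensional ℚ_[p] K] (hE : Module.finrank K E = 2)
    (hram : ¬ IsUnramified E) (hπ : IsUniformizer π) :
    residueCard D.Es = residueCard E ^ Module.finrank E D.Es := by
  have := D.finiteDimensional_E_Es hE hram hπ
  have := D.finite_resField_Es hE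
  have := completeSpace_E hE
  exact (exists_orthonormal_basis D.norm_algebraMap hπ (D.exists_norm_eq hE hram hπ)).1

theorem exists_basis [FiniteDimensional ℚ_[p] K] (hE : Module.finrank K E = 2)
    (hram : ¬ IsUnramified E) (hπ : IsUniformizer π) :
    ∃ β : Module.Basis (Fin (Module.finrank E D.Es)) E D.Es, (∀ i, ‖β i‖ ≤ 1) ∧
      ∀ x i, ‖β.repr x i‖ ≤ ‖x‖ := by
  have := D.finiteDimensional_E_Es hE hram hπ
  have := D.finite_resField_Es hE
  have := completeSpace_E hE
  exact (exists_orthonormal_basis D.norm_algebraMap hπ (D.exists_norm_eq hE hram hπ)).2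

/-- The Frobenius as an automorphism over `E`. -/
def frob : D.Es ≃ₐ[E] D.Es := { D.σ with commutes' := D.σ_fixes }

theorem norm_frob (x : D.Es) : ‖D.frob x‖ = ‖x‖ := norm_algEquiv D.Es D.σ x

theorem norm_η (x : D.Es) : ‖D.η x‖ = ‖x‖ := norm_algEquiv D.Es D.η x

theorem actsAsPow_frob : ActsAsPow D.frob (residueCard E) :=
  actsAsPow_of_norm_sub_lt D.norm_frob D.σ_frob

/-- The automorphism `τ` is in the inertia group. -/
theorem actsAsPow_τ (hE : Module.finrank K E = 2) (hram : ¬ IsUnramified E)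
    (hπ : IsUniformizer π) : ActsAsPow D.τ 1 := by
  refine actsAsPow_of_norm_sub_lt (norm_algEquiv D.Es D.τ) fun x hx => ?_
  obtain ⟨a, b, h⟩ := D.exists_eq_add_mul hE hram hπ x
  have hmem : ∀ c : D.Ks, (c : PadicAlgCl p) ∈ D.Es := fun c =>
    (le_sup_right : D.Ks ≤ E ⊔ D.Ks) c.2
  obtain ⟨a', ha'⟩ : ∃ a' : D.Es, (a' : PadicAlgCl p) = a := ⟨⟨a, hmem a⟩, rfl⟩
  obtain ⟨b', hb'⟩ : ∃ b' : D.Es, (b' : PadicAlgCl p) = b := ⟨⟨b, hmem b⟩, rfl⟩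
  have hx' : x = a' + b' * algebraMap E D.Es π :=
    Subtype.ext (by rw [h, ← ha', ← hb']; rfl)
  have hτa : D.τ a' = a' := D.τ_fixes a' (by rw [ha']; exact a.2)
  -- `τ` moves only the term `bπ`, whose norm is at most 1 but cannot equal 1, as `‖π‖` is not a
  -- value of `K`.
  have hnb : ‖b' * algebraMap E D.Es π‖ < 1 := by
    have h1 := norm_add_mul_uniformizer hram hπ D.unramified a b
    have h2 : ‖(b : PadicAlgCl p) * (π : PadicAlgCl p)‖ ≤ 1 := by
      refine (le_max_right ‖(a : PadicAlgCl p)‖ _).trans ?_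
      rw [← h1, ← h]; exact hx
    have h3 : ‖b' * algebraMap E D.Es π‖ = ‖(b : PadicAlgCl p) * (π : PadicAlgCl p)‖ := by
      rw [← hb']; rfl
    rw [h3]
    refine lt_of_le_of_ne h2 fun h4 => ?_
    obtain ⟨y, hy⟩ := D.unramified b
    have hy' : ‖(b : PadicAlgCl p)‖ = ‖y‖ := hy
    rw [norm_mul, hy'] at h4
    refine norm_uniformizer_ne hram hπ y⁻¹ ?_
    rw [norm_inv]
    exact (eq_inv_of_mul_eq_one_right h4).symm
  have h5 : D.τ x - x ^ 1 = D.τ (b' * algebraMap E D.Es π) - b' * algebraMap E D.Es π := by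
    rw [hx', map_add, hτa]; ring
  rw [h5, sub_eq_add_neg]
  refine (IsUltrametricDist.norm_add_le_max _ _).trans_lt ?_
  rw [norm_neg, norm_algEquiv, max_self]
  exact hnb

theorem η_apply (x : D.Es) : D.η x = D.τ (D.frob^[D.s / 2] x) := by
  have h : ∀ n : ℕ, (D.σ ^ n) x = D.frob^[n] x := fun n => by
    rw [AlgEquiv.coe_pow]; rfl
  rw [← h]; rfl

/-- `τ` is invisible on the residue field, so `η` acts there as the power of Frobenius alone. -/
theorem actsAsPow_η (hE : Module.finrank K E = 2) (hram : ¬ IsUnramified E)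
    (hπ : IsUniformizer π) : ActsAsPow D.η (residueCard E ^ (D.s / 2)) := by
  have h := (D.actsAsPow_τ hE hram hπ).comp (D.actsAsPow_frob.iterate (D.s / 2))
  rw [one_mul] at h
  exact h.congr fun x => (D.η_apply x).symm

theorem η_algebraMap (a : E) : D.η (algebraMap E D.Es a) = D.τ (algebraMap E D.Es a) := by
  rw [η_apply, Function.iterate_fixed (D.frob.commutes a)]

/-- The quadratic extension `E/K` is normal, so `τ` restricts to an automorphism of `E`, of order at
most 2. -/
theorem τ_τ_algebraMap (hE : Module.finrank K E = 2) (a : E) :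
    ∃ b : E, D.τ (algebraMap E D.Es a) = algebraMap E D.Es b ∧
      D.τ (algebraMap E D.Es b) = algebraMap E D.Es a := by
  have h1 : Algebra.IsQuadraticExtension K E := ⟨hE⟩
  have h2 : FiniteDimensional K E := Module.finite_of_finrank_pos (by omega)
  let ρ : E ≃ₐ[K] E := D.τ.restrictNormal E
  have hρ : ∀ a, algebraMap E D.Es (ρ a) = D.τ (algebraMap E D.Es a) :=
    D.τ.restrictNormal_commutes E
  have hcard : Fintype.card (E ≃ₐ[K] E) ≤ 2 := hE ▸ AlgEquiv.card_le
  have hle : orderOf ρ ≤ 2 := orderOf_le_card_univ.trans hcard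
  have hpos : 0 < orderOf ρ := orderOf_pos ρ
  have hsq : ρ ^ 2 = 1 := by
    rw [← orderOf_dvd_iff_pow_eq_one]
    interval_cases orderOf ρ <;> norm_num
  refine ⟨ρ a, (hρ a).symm, ?_⟩
  rw [← hρ]
  congr 1
  rw [pow_two] at hsq
  exact DFunLike.congr_fun hsq a

/-- `η` restricts to `τ` on `E`, so its square is `E`-linear. That square acts on the residue field
as the `s`-th power of Frobenius (trivially if `s = 1`), so it is the identity there, hence on
`E_s`. Commutation of `σ` and `τ` is not needed. -/
theorem η_η [FiniteDimensional ℚ_[p] K] (hE : Module.finrank K E = 2)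
    (hram : ¬ IsUnramified E) (hπ : IsUniformizer π) (x : D.Es) : D.η (D.η x) = x := by
  have := D.finiteDimensional_E_Es hE hram hπ
  have := D.finite_resField_Es hE
  let ρ : D.Es ≃ₐ[E] D.Es :=
    { (D.η * D.η) with
      commutes' := fun a => by
        obtain ⟨b, h1, h2⟩ := D.τ_τ_algebraMap hE a
        change D.η (D.η (algebraMap E D.Es a)) = algebraMap E D.Es a
        rw [η_algebraMap, h1, η_algebraMap, h2] }
  have hρ : ∀ x, ρ x = D.η (D.η x) := fun _ => rfl
  have hq := D.residueCard_Es hE hram hπ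
  have h1 : ρ = 1 := by
    refine eq_one_of_actsAsPow_one hq D.actsAsPow_frob fun x hx => ?_
    have h := (D.actsAsPow_η hE hram hπ).comp (D.actsAsPow_η hE hram hπ) x hx
    rw [hρ]
    refine h.2.trans ?_
    rcases D.s_eq with hs | ⟨-, r, hr⟩
    · rw [hs]; simp
    · rw [← pow_add, show D.s / 2 + D.s / 2 = D.s by omega, ← D.finrank_E_Es hE hram hπ, ← hq,
        red_pow_residueCard]
  rw [← hρ, h1]
  rfl

theorem one_lt_residueCard_E (D : ElementaryDatum E) [FiniteDimensional ℚ_[p] K] (hE : Module.finrank K E = 2)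
    (hram : ¬ IsUnramified E) (hπ : IsUniformizer π) : 1 < residueCard E := by
  have := D.finite_resField_Es hE
  exact one_lt_residueCard_of_pow (D.residueCard_Es hE hram hπ)

theorem residueCard_Es_of_even [FiniteDimensional ℚ_[p] K] (hE : Module.finrank K E = 2)
    (hram : ¬ IsUnramified E) (hπ : IsUniformizer π) (hs : D.s ≠ 1) :
    residueCard D.Es = (residueCard E ^ (D.s / 2)) ^ 2 ∧ 1 < residueCard E ^ (D.s / 2) := by
  rcases D.s_eq with h | ⟨h0, r, hr⟩
  · exact absurd h hs
  refine ⟨?_, Nat.one_lt_pow (by omega) (D.one_lt_residueCard_E hE hram hπ)⟩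
  rw [D.residueCard_Es hE hram hπ, D.finrank_E_Es hE hram hπ, ← pow_mul]
  congr 1; omega

theorem η_ne_one [FiniteDimensional ℚ_[p] K] (hE : Module.finrank K E = 2)
    (hram : ¬ IsUnramified E) (hπ : IsUniformizer π) : D.η ≠ 1 := by
  by_cases hs : D.s = 1
  · intro h
    refine D.τ_ne_one ?_
    rw [← h, η, hs, show 1 / 2 = 0 from rfl, pow_zero, mul_one]
  · intro h
    have := D.finite_resField_Es hE
    obtain ⟨h1, h2⟩ := D.residueCard_Es_of_even hE hram hπ hs
    have h3 := (D.actsAsPow_η hE hram hπ).congr (ρ' := id) fun x => by rw [h]; rfl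
    have h4 := h3.eq_one (by omega) (by rw [h1]; exact lt_self_pow₀ h2 one_lt_two)
    omega

theorem orderOf_η [FiniteDimensional ℚ_[p] K] (hE : Module.finrank K E = 2)
    (hram : ¬ IsUnramified E) (hπ : IsUniformizer π) : orderOf D.η = 2 :=
  orderOf_eq_prime (AlgEquiv.ext fun x => by
    rw [pow_two]; exact D.η_η hE hram hπ x) (D.η_ne_one hE hram hπ)

theorem finrank_L_Es [FiniteDimensional ℚ_[p] K] (hE : Module.finrank K E = 2)
    (hram : ¬ IsUnramified E) (hπ : IsUniformizer π) : Module.finrank D.L D.Es = 2 := by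
  have := D.finiteDimensional_K_Es hE hram hπ
  rw [IntermediateField.finrank_fixedField_eq_card, Nat.card_zpowers, D.orderOf_η hE hram hπ]

theorem mem_L_iff (x : D.Es) : x ∈ D.L ↔ D.η x = x := by
  rw [IntermediateField.mem_fixedField_iff]
  refine ⟨fun h => h _ (Subgroup.mem_zpowers _), fun h f hf => ?_⟩
  have h1 : Subgroup.zpowers D.η ≤ MulAction.stabilizer (D.Es ≃ₐ[K] D.Es) x := by
    rw [Subgroup.zpowers_le]; exact h
  exact h1 hf

/-- The automorphism `η` over its fixed field. -/
def ηL : D.Es ≃ₐ[D.L] D.Es :=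
  { D.η with commutes' := fun a => (D.mem_L_iff a).1 a.2 }

/-- `E_s/L` has degree 2, so its automorphisms are exactly `1` and `η`. -/
theorem algebraMap_norm [FiniteDimensional ℚ_[p] K] (hE : Module.finrank K E = 2)
    (hram : ¬ IsUnramified E) (hπ : IsUniformizer π) (x : D.Es) :
    algebraMap D.L D.Es (Algebra.norm D.L x) = x * D.η x := by
  classical
  have h2 := D.finrank_L_Es hE hram hπ
  have h3 : FiniteDimensional D.L D.Es := Module.finite_of_finrank_pos (by omega)
  have hne : (1 : D.Es ≃ₐ[D.L] D.Es) ≠ D.ηL := fun h =>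
    D.η_ne_one hE hram hπ (AlgEquiv.ext fun x => (DFunLike.congr_fun h x).symm)
  have hle : Fintype.card (D.Es ≃ₐ[D.L] D.Es) ≤ 2 := h2 ▸ AlgEquiv.card_le
  have hpair : ({1, D.ηL} : Finset (D.Es ≃ₐ[D.L] D.Es)).card = 2 := Finset.card_pair hne
  have huniv : (Finset.univ : Finset (D.Es ≃ₐ[D.L] D.Es)) = {1, D.ηL} :=
    (Finset.eq_of_subset_of_card_le (Finset.subset_univ _) (by
      rw [hpair, Finset.card_univ]; exact hle)).symm
  have h4 : IsGalois D.L D.Es := IsGalois.of_card_aut_eq_finrank D.L D.Es (by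
    rw [Nat.card_eq_fintype_card, ← Finset.card_univ, huniv, hpair, h2])
  rw [Algebra.norm_eq_prod_automorphisms, huniv, Finset.prod_pair hne]
  rfl

theorem norm_eq_one_iff [FiniteDimensional ℚ_[p] K] (hE : Module.finrank K E = 2)
    (hram : ¬ IsUnramified E) (hπ : IsUniformizer π) (x : D.Es) :
    Algebra.norm D.L x = 1 ↔ x * D.η x = 1 := by
  rw [← D.algebraMap_norm hE hram hπ, map_eq_one_iff _ (algebraMap D.L D.Es).injective]

theorem norm_eq_one_of_mul_η {x : D.Es} (h : x * D.η x = 1) : ‖x‖ = 1 := by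
  have h1 := congrArg norm h
  rw [norm_mul, D.norm_η, norm_one, ← pow_two] at h1
  exact (pow_eq_one_iff_of_nonneg (norm_nonneg x) two_ne_zero).1 h1

/-- For even `s`, `η` acts nontrivially on the residue field, so some fixed element has the norm of
`π`: `E_s/L` is unramified. -/
theorem norm_πL_of_ne_one [FiniteDimensional ℚ_[p] K] (hE : Module.finrank K E = 2)
    (hram : ¬ IsUnramified E) (hπ : IsUniformizer π) (hs : D.s ≠ 1) : ‖D.πL‖ = ‖π‖ := by
  have := D.finite_resField_Es hE
  obtain ⟨h1, h2⟩ := D.residueCard_Es_of_even hE hram hπ hs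
  have hπ0 : algebraMap E D.Es π ≠ 0 := (map_ne_zero _).2 hπ.1
  obtain ⟨y, hy, hyn⟩ := exists_fixed_norm_eq (η := D.η.toRingEquiv) D.norm_η
    (D.η_η hE hram hπ) (D.actsAsPow_η hE hram hπ) h2
    (by rw [h1]; exact lt_self_pow₀ h2 one_lt_two) hπ0
  have hyn' : ‖y‖ = ‖π‖ := hyn
  refine le_antisymm ?_ ?_
  · obtain ⟨a, ha⟩ := D.exists_norm_eq hE hram hπ (D.πL : D.Es)
    have h3 : ‖D.πL‖ = ‖a‖ := ha
    rw [h3]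
    exact hπ.2.2 a (h3 ▸ D.πL_uniformizer.2.1)
  · have h4 : ‖(⟨y, (D.mem_L_iff y).2 hy⟩ : D.L)‖ ≤ ‖D.πL‖ :=
      D.πL_uniformizer.2.2 _ (by change ‖y‖ < 1; rw [hyn']; exact hπ.2.1)
    rw [← hyn']; exact h4

/-- For `s = 1`, `η` is `τ`, which moves `π`; a fixed `a + bπ` therefore has `b = 0` and lies in the
unramified `K_s`. -/
theorem exists_norm_eq_of_mem_L (hE : Module.finrank K E = 2) (hram : ¬ IsUnramified E)
    (hπ : IsUniformizer π) (hs : D.s = 1) {x : D.Es} (hx : D.η x = x) : ∃ y : K, ‖x‖ = ‖y‖ := by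
  have hητ : ∀ x, D.η x = D.τ x := fun x => by
    rw [D.η_apply, hs, show 1 / 2 = 0 from rfl, Function.iterate_zero, id]
  have hdec : ∀ x : D.Es, ∃ a b : D.Es, (a : PadicAlgCl p) ∈ D.Ks ∧ (b : PadicAlgCl p) ∈ D.Ks ∧
      x = a + b * algebraMap E D.Es π := fun x => by
    obtain ⟨a, b, h⟩ := D.exists_eq_add_mul hE hram hπ x
    exact ⟨⟨a, (le_sup_right : D.Ks ≤ E ⊔ D.Ks) a.2⟩, ⟨b, (le_sup_right : D.Ks ≤ E ⊔ D.Ks) b.2⟩,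
      a.2, b.2, Subtype.ext h⟩
  have hτπ : D.τ (algebraMap E D.Es π) ≠ algebraMap E D.Es π := fun h => by
    refine D.τ_ne_one (AlgEquiv.ext fun x => ?_)
    obtain ⟨a, b, ha, hb, rfl⟩ := hdec x
    rw [map_add, map_mul, D.τ_fixes a ha, D.τ_fixes b hb, h]
    rfl
  obtain ⟨a, b, ha, hb, rfl⟩ := hdec x
  rw [hητ, map_add, map_mul, D.τ_fixes a ha, D.τ_fixes b hb, add_right_inj] at hx
  have hb0 : b = 0 := by
    by_contra hb0
    exact hτπ (mul_left_cancel₀ hb0 hx)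
  rw [hb0, zero_mul, add_zero]
  exact D.unramified ⟨a, ha⟩

/-- The norm `x η(x)` lies in `L` and has absolute value `‖x‖ ^ 2`. -/
theorem sq_norm_le_norm_πL (hη : ∀ x, D.η (D.η x) = x) (x : D.Es) (hx : ‖x‖ < 1) :
    ‖x‖ ^ 2 ≤ ‖D.πL‖ := by
  have hzn : ‖x * D.η x‖ = ‖x‖ ^ 2 := by rw [norm_mul, D.norm_η, pow_two]
  have hzL : x * D.η x ∈ D.L := (D.mem_L_iff _).2 (by rw [map_mul, hη, mul_comm])
  have h4 : ‖(⟨x * D.η x, hzL⟩ : D.L)‖ ≤ ‖D.πL‖ :=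
    D.πL_uniformizer.2.2 ⟨x * D.η x, hzL⟩
      (hzn.trans_lt (pow_lt_one₀ (norm_nonneg _) hx two_ne_zero))
  exact hzn.ge.trans h4

/-- Write `‖π_L‖ = ‖π‖ ^ n` with `n > 0`. Values of `L` are values of `K`, so `n ≠ 1`; the norm of
`π` lies in `L`, so `n ≤ 2`. -/
theorem norm_πL_of_eq_one [FiniteDimensional ℚ_[p] K] (hE : Module.finrank K E = 2)
    (hram : ¬ IsUnramified E) (hπ : IsUniformizer π) (hs : D.s = 1) : ‖D.πL‖ = ‖π‖ ^ 2 := by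
  obtain ⟨y, hny⟩ := D.exists_norm_eq_of_mem_L hE hram hπ hs (D.mem_L_iff _ |>.1 D.πL.2)
  have hny : ‖D.πL‖ = ‖y‖ := hny
  have hLpos : 0 < ‖D.πL‖ := D.πL_uniformizer.norm_pos
  obtain ⟨a, ha⟩ := D.exists_norm_eq hE hram hπ (D.πL : D.Es)
  have ha' : ‖D.πL‖ = ‖a‖ := ha
  obtain ⟨n, hn⟩ := hπ.exists_norm_eq_zpow (norm_pos_iff.1 (ha' ▸ hLpos))
  rw [← ha'] at hn
  have hn0 : 0 < n := by
    have := D.πL_uniformizer.2.1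
    rw [hn, ← zpow_zero ‖π‖, hπ.zpow_lt_zpow_iff] at this
    exact this
  have hn1 : n ≠ 1 := by
    rintro rfl
    rw [zpow_one] at hn
    exact norm_uniformizer_ne hram hπ y (hny.symm.trans hn)
  have hn2 : n ≤ 2 := by
    have h5 := D.sq_norm_le_norm_πL (D.η_η hE hram hπ) (algebraMap E D.Es π)
      (by rw [D.norm_algebraMap]; exact hπ.2.1)
    rw [D.norm_algebraMap, hn] at h5
    exact hπ.zpow_le_zpow_iff.1 h5
  obtain rfl : n = 2 := by omega
  exact hn

end ElementaryDatum

/-! ### The Hermitian form and the torus on the product. -/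

section Torus

variable {p : ℕ} [Fact p.Prime] {K : IntermediateField ℚ_[p] (PadicAlgCl p)}
  {E : IntermediateField K (PadicAlgCl p)} {π : E} {j : ℕ} (D : Fin j → ElementaryDatum E)

theorem prodLattice_eq_box (hπ : IsUniformizer π) (b : Fin j → ℤ) :
    prodLattice D π b = box (fun i => (D i).Es) π b := by
  ext v
  refine forall_congr' fun i => ?_
  have hb : 0 < ‖π‖ ^ b i := zpow_pos hπ.norm_pos _
  constructor
  · rintro ⟨y, hy, h⟩
    rw [h, Algebra.smul_def, norm_mul, (D i).norm_algebraMap, norm_zpow]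
    exact mul_le_of_le_one_right hb.le hy
  · intro h
    refine ⟨(π ^ b i)⁻¹ • v i, ?_, (smul_inv_smul₀ (zpow_ne_zero _ hπ.1) _).symm⟩
    rw [Algebra.smul_def, norm_mul, (D i).norm_algebraMap, norm_inv, norm_zpow,
      inv_mul_le_iff₀ hb, mul_one]
    exact h

/-- The exponents of the forms `Tr (κ / π_L · x · η y)`. -/
def formExponent (k : Fin j → ℤ) (i : Fin j) : ℤ :=
  if (D i).s = 1 then 2 * (k i - 1) else k i - 1

theorem mulAut_smul_mk (t : (Space D)ˣ) (N : VNorm E (Space D)) :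
    mulAut D t • BuildingGL.mk N = BuildingGL.mk N ↔
      ∃ c : ℝ, 0 < c ∧ ∀ v, N v = c * N ((t⁻¹ : (Space D)ˣ) * v) :=
  ⟨fun h => Quotient.exact h, fun h => Quotient.sound h⟩

variable [FiniteDimensional ℚ_[p] K] (hE : Module.finrank K E = 2) (hram : ¬ IsUnramified E)
  (hπ : IsUniformizer π)

include hE hram hπ

theorem norm_κ_div_πL {k : Fin j → ℤ} (hk : ∀ i, ‖(D i).κ‖ = ‖(D i).πL‖ ^ k i) (i : Fin j) :
    ‖((D i).κ : (D i).Es) / ((D i).πL : (D i).Es)‖ = ‖π‖ ^ formExponent D k i := by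
  have h1 : ‖((D i).κ : (D i).Es) / ((D i).πL : (D i).Es)‖ = ‖(D i).κ‖ / ‖(D i).πL‖ :=
    norm_div _ _
  have h0 := hπ.norm_pos.ne'
  rw [h1, hk, formExponent]
  split_ifs with hs
  · rw [(D i).norm_πL_of_eq_one hE hram hπ hs, div_eq_mul_inv, ← zpow_sub_one₀ (pow_ne_zero 2 h0), ← zpow_natCast,
      ← zpow_mul]
    rfl
  · rw [(D i).norm_πL_of_ne_one hE hram hπ hs, div_eq_mul_inv, ← zpow_sub_one₀ h0]

/-- The bound holds because `η` is isometric and the trace does not increase norms. It is attained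
because some unit of `E_s` has unit trace. -/
theorem isSplitForm_hermForm {k : Fin j → ℤ} (hk : ∀ i, ‖(D i).κ‖ = ‖(D i).πL‖ ^ k i) :
    IsSplitForm (M := fun i => (D i).Es) (hermForm D) fun i => ‖π‖ ^ formExponent D k i := by
  have hfd := fun i => (D i).finiteDimensional_E_Es hE hram hπ
  have hfin := fun i => (D i).finite_resField_Es hE
  have hμ := norm_κ_div_πL D hE hram hπ hk
  constructor
  · intro v w B hB h
    refine IsUltrametricDist.norm_sum_le_of_forall_le_of_nonneg hB fun i _ => ?_
    refine (norm_trace_le (D i).norm_algebraMap ((D i).residueCard_Es hE hram hπ)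
      (D i).actsAsPow_frob (D i).norm_frob _).trans ?_
    rw [norm_mul, norm_mul, hμ, (D i).norm_η]
    exact h i
  · intro v i hi a
    obtain ⟨y, hy, hty⟩ := exists_norm_trace_eq_one (D i).norm_algebraMap
      ((D i).residueCard_Es hE hram hπ) (D i).actsAsPow_frob (D i).norm_frob
    have hμ0 : ((D i).κ : (D i).Es) / ((D i).πL : (D i).Es) ≠ 0 :=
      norm_pos_iff.1 (by rw [hμ]; exact zpow_pos hπ.norm_pos _)
    obtain ⟨u, hu⟩ : ∃ u, u = ((D i).κ : (D i).Es) / ((D i).πL : (D i).Es) * v i := ⟨_, rfl⟩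
    have hu0 : u ≠ 0 := hu ▸ mul_ne_zero hμ0 hi
    have hun : ‖u‖ = ‖π‖ ^ formExponent D k i * ‖v i‖ := by rw [hu, norm_mul, hμ]
    -- The scalar `d` compensates the norm of `u`, so the test vector has norm `‖a‖`. It is taken as
    -- an image under `η`, so that the `η` in the form cancels and leaves `a d` times the trace of
    -- `y`.
    obtain ⟨d, hd⟩ := (D i).exists_norm_eq hE hram hπ u
    have hzn : ‖(a * d) • (y / u)‖ = ‖a‖ := by
      rw [Algebra.smul_def, norm_mul, (D i).norm_algebraMap, norm_mul, norm_div, hy, ← hd]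
      field_simp [norm_ne_zero_iff.2 hu0]
    have hηz : ‖(D i).η ((a * d) • (y / u))‖ = ‖a‖ := ((D i).norm_η _).trans hzn
    refine ⟨(D i).η ((a * d) • (y / u)), hηz, ?_⟩
    have hform : hermForm D v (Pi.single i ((D i).η ((a * d) • (y / u)))) =
        a * d * Algebra.trace E (D i).Es y := by
      rw [hermForm, Finset.sum_eq_single i]
      · rw [Pi.single_eq_same, (D i).η_η hE hram hπ, ← hu, mul_smul_comm,
          mul_div_cancel₀ _ hu0, map_smul, smul_eq_mul]
      · intro l _ hl
        rw [Pi.single_eq_of_ne hl, map_zero, mul_zero, map_zero]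
      · exact fun h => absurd (Finset.mem_univ i) h
    rw [hform, norm_mul, norm_mul, hty, mul_one, hηz, ← hd, hun, mul_comm]

theorem mem_torus_iff {t : (Space D)ˣ} :
    t ∈ torus D ↔ ∀ i, (t : Space D) i * (D i).η ((t : Space D) i) = 1 :=
  forall_congr' fun i => (D i).norm_eq_one_iff hE hram hπ _

theorem norm_eq_one_of_mem_torus {t : (Space D)ˣ} (ht : t ∈ torus D) (i : Fin j) :
    ‖(t : Space D) i‖ = 1 :=
  (D i).norm_eq_one_of_mul_η ((mem_torus_iff D hE hram hπ).1 ht i)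

theorem exists_mem_torus (i : Fin j) {t : (D i).Es} (ht : t * (D i).η t = 1) :
    ∃ u ∈ torus D, (u : Space D) i = t ∧ ∀ l, l ≠ i → (u : Space D) l = 1 := by
  classical
  have ht0 : t ≠ 0 := left_ne_zero_of_mul_eq_one ht
  have h : ∀ l, l = i ∨ l ≠ i := fun l => eq_or_ne l i
  refine ⟨⟨Pi.mulSingle i t, Pi.mulSingle i t⁻¹, ?_, ?_⟩,
    (mem_torus_iff D hE hram hπ).2 fun l => ?_, Pi.mulSingle_eq_same _ _,
    fun l hl => Pi.mulSingle_eq_of_ne hl _⟩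
  · rw [← Pi.mulSingle_mul, mul_inv_cancel₀ ht0, Pi.mulSingle_one]
  · rw [← Pi.mulSingle_mul, inv_mul_cancel₀ ht0, Pi.mulSingle_one]
  · change (Pi.mulSingle i t : Space D) l * (D l).η ((Pi.mulSingle i t : Space D) l) = 1
    rcases h l with rfl | hl
    · rw [Pi.mulSingle_eq_same]; exact ht
    · rw [Pi.mulSingle_eq_of_ne hl, map_one, mul_one]

/-- The topology on units is that of pairs `(t, t⁻¹)`, a closed subspace of the product. Both
entries stay in a compact unit polydisc, and `t η(t) = 1` is a closed condition. -/
theorem isCompact_torus : IsCompact (torus D : Set (Space D)ˣ) := by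
  have hprop := fun i => (D i).properSpace_Es hE
  have hball : IsCompact (Set.pi Set.univ fun i => Metric.closedBall (0 : (D i).Es) 1) :=
    isCompact_univ_pi fun i => isCompact_closedBall 0 1
  have hcomp := (Units.isClosedEmbedding_embedProduct (α := Space D)).isCompact_preimage
    (hball.prod (hball.image (MulOpposite.continuous_op (M := Space D))))
  refine hcomp.of_isClosed_subset ?_ fun t ht => ?_
  · have h : (torus D : Set (Space D)ˣ) =
        ⋂ i, {t : (Space D)ˣ | (t : Space D) i * (D i).η ((t : Space D) i) = 1} := by
      ext t
      rw [Set.mem_iInter]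
      exact mem_torus_iff D hE hram hπ
    rw [h]
    refine isClosed_iInter fun i => isClosed_eq ?_ continuous_const
    have h1 : Continuous fun t : (Space D)ˣ => (t : Space D) i :=
      (continuous_apply i).comp Units.continuous_val
    have h2 : Continuous (D i).η :=
      (AddMonoidHomClass.isometry_of_norm (D i).η (D i).norm_η).continuous
    exact h1.mul (h2.comp h1)
  · refine ⟨fun i _ => ?_, ⟨((t⁻¹ : (Space D)ˣ) : Space D), fun i _ => ?_, rfl⟩⟩
    · rw [mem_closedBall_zero_iff]
      exact (norm_eq_one_of_mem_torus D hE hram hπ ht i).le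
    · rw [mem_closedBall_zero_iff]
      exact (norm_eq_one_of_mem_torus D hE hram hπ ((torus D).inv_mem ht) i).le

theorem torusGL_le_unitaryGroup : torusGL D ≤ unitaryGroup (hermForm D) := by
  rintro _ ⟨t, ht, rfl⟩ v w
  refine Finset.sum_congr rfl fun i _ => congrArg _ ?_
  have h := (mem_torus_iff D hE hram hπ).1 ht i
  change _ * ((t : Space D) i * v i) * (D i).η ((t : Space D) i * w i) = _
  rw [map_mul]
  linear_combination (((D i).κ : (D i).Es) / ((D i).πL : (D i).Es)) * v i * (D i).η (w i) * h

/-- A norm whose class is fixed by the torus is a weighted maximum norm. -/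
theorem eq_maxVNorm_of_fixed (hp : p ≠ 2) (N : VNorm E (Space D))
    (hN : ∀ g ∈ torusGL D, g • BuildingGL.mk N = BuildingGL.mk N) :
    ∃ (c : Fin j → ℝ) (hc : ∀ i, 0 < c i),
      N = maxVNorm (fun i => (D i).norm_algebraMap) c hc := by
  have hfd := fun i => (D i).finiteDimensional_E_Es hE hram hπ
  have hfin := fun i => (D i).finite_resField_Es hE
  choose β hβ1 hβ using fun i => (D i).exists_basis hE hram hπ
  have hinv := N.invariant_of_mul (T := torus D)
    (fun t ht i => norm_eq_one_of_mem_torus D hE hram hπ ht i) β hβ (fun t ht => by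
      obtain ⟨c, hc, h⟩ := (mulAut_smul_mk D t⁻¹ N).1 (hN _ ⟨t⁻¹, (torus D).inv_mem ht, rfl⟩)
      refine ⟨c⁻¹, inv_pos.2 hc, fun v => ?_⟩
      rw [h v, inv_inv, inv_mul_cancel_left₀ hc.ne'])
  refine N.eq_maxVNorm (fun i => (D i).norm_algebraMap) (norm_two_eq_one hp E) hinv
    (fun i => ?_) (fun i N' hN' => ?_)
  · obtain ⟨u, hu, h1, h2⟩ := exists_mem_torus D hE hram hπ i (t := -1) (by simp)
    refine ⟨u, hu, funext fun l => ?_⟩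
    by_cases hl : l = i
    · subst hl
      rw [h1, Pi.sub_apply, Pi.single_eq_same, Pi.one_apply]; norm_num
    · rw [h2 l hl, Pi.sub_apply, Pi.single_eq_of_ne hl, Pi.one_apply, sub_zero]
  · by_cases hs : (D i).s = 1
    · intro x
      have h1 : Module.finrank E (D i).Es = 1 := ((D i).finrank_E_Es hE hram hπ).trans hs
      obtain ⟨a, rfl⟩ := (finrank_eq_one_iff_of_nonzero' (1 : (D i).Es) one_ne_zero).1 h1 x
      rw [N'.map_smul, Algebra.smul_def, mul_one]
      rfl
    · obtain ⟨h1, h2⟩ := (D i).residueCard_Es_of_even hE hram hπ hs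
      obtain ⟨C, -, hC⟩ := N'.exists_le_mul (β i) (hβ i)
      refine N'.eq_mul_of_normOne_invariant (D i).norm_algebraMap hπ
        ((D i).exists_norm_eq hE hram hπ) (η := (D i).η.toRingEquiv) (D i).norm_η
        ((D i).η_η hE hram hπ) ((D i).actsAsPow_η hE hram hπ) h2 h1 hC
        fun t ht x => ?_
      obtain ⟨u, hu, rfl, -⟩ := exists_mem_torus D hE hram hπ i ht
      exact hN' u hu x

end Torus

end UnitaryBuilding

end

theorem theorem5p2 {p : ℕ} [Fact p.Prime] (hp : p ≠ 2)
    -- `K` is a finite extension of `ℚ_p`, and `E / K` is a ramified quadratic extension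
    (K : IntermediateField ℚ_[p] (PadicAlgCl p)) [FiniteDimensional ℚ_[p] K]
    (E : IntermediateField K (PadicAlgCl p)) (hE : Module.finrank K E = 2)
    (hram : ¬ UnitaryBuilding.IsUnramified E)
    (π : E) (hπ : UnitaryBuilding.IsUniformizer π)
    -- the elementary tori and Hermitian spaces; at most one of the `s_i` is `1`, the others are even
    {j : ℕ} (D : Fin j → UnitaryBuilding.ElementaryDatum E)
    (hodd : ∀ i i', (D i).s = 1 → (D i').s = 1 → i = i')
    -- the normalized valuations `k i = v_{L_i} (κ_i)`
    (k : Fin j → ℤ) (hk : ∀ i, ‖(D i).κ‖ = ‖(D i).πL‖ ^ k i) :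
    -- `T(K)` is compact and acts on `V` through the unitary group
    IsCompact (UnitaryBuilding.torus D : Set (UnitaryBuilding.Space D)ˣ) ∧
    UnitaryBuilding.torusGL D ≤
      UnitaryBuilding.unitaryGroup (UnitaryBuilding.hermForm D) ∧
    ∃ x ∈ UnitaryBuilding.buildingU (UnitaryBuilding.hermForm D),
      -- `x` is the vertex given by the lattice `∏ i, π_E ^ (b i) 𝓞_{E_{s_i}}`
      UnitaryBuilding.IsVertexOfLattice (UnitaryBuilding.hermForm D) π
        (UnitaryBuilding.prodLattice D π
          (fun i => if (D i).s = 1 then 1 - k i else ⌊((1 - k i : ℤ) : ℚ) / 2⌋)) x ∧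
      -- `T(K)` fixes `x`
      (∀ g ∈ UnitaryBuilding.torusGL D, g • x = x) ∧
      -- `T(K)` fixes no other vertex
      (∀ y, UnitaryBuilding.IsVertex (UnitaryBuilding.hermForm D) π y →
        (∀ g ∈ UnitaryBuilding.torusGL D, g • y = y) → y = x) ∧
      -- `T(K)` fixes no other point of the building
      (∀ y ∈ UnitaryBuilding.buildingU (UnitaryBuilding.hermForm D),
        (∀ g ∈ UnitaryBuilding.torusGL D, g • y = y) → y = x) := by
  open UnitaryBuilding in
  have hnorm := fun i => (D i).norm_algebraMap
  have hval := fun i => (D i).exists_norm_eq hE hram hπ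
  have hφ := isSplitForm_hermForm D hE hram hπ hk
  choose β hβ1 hβ using fun i => (D i).exists_basis hE hram hπ
  -- For `s = 1` the exponent is even and the division is exact; otherwise integer division rounds
  -- down, as the floor does.
  have hb : (fun i => if (D i).s = 1 then 1 - k i else ⌊((1 - k i : ℤ) : ℚ) / 2⌋) =
      fun i => -formExponent D k i / 2 := by
    funext i
    rw [formExponent]
    split_ifs
    · omega
    · rw [neg_sub]
      exact_mod_cast Rat.floor_intCast_div_natCast (1 - k i) 2
  refine ⟨isCompact_torus D hE hram hπ, torusGL_le_unitaryGroup D hE hram hπ,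
    BuildingGL.mk (selfDualNorm hπ hnorm (formExponent D k)),
    mk_selfDualNorm_mem hπ hnorm hφ, ⟨?_, selfDualNorm hπ hnorm (formExponent D k), rfl, ?_⟩, ?_,
    ?_, ?_⟩
  · rw [hb, prodLattice_eq_box D hπ]
    exact isAlmostSelfDual_box hπ hnorm hφ β hβ1 hβ
  · intro v
    rw [hb, prodLattice_eq_box D hπ]
    exact (sqrt_latticeNorm_box hπ hnorm hval hφ v).symm
  · rintro _ ⟨t, ht, rfl⟩
    refine (mulAut_smul_mk D t _).2 ⟨1, one_pos, fun v => ?_⟩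
    rw [one_mul]
    refine iSup_congr fun i => ?_
    rw [Pi.mul_apply, norm_mul,
      norm_eq_one_of_mem_torus D hE hram hπ ((torus D).inv_mem ht), one_mul]
  · rintro y ⟨Λ, hΛ, N, rfl, hN⟩ hy
    obtain ⟨c, hc, rfl⟩ := eq_maxVNorm_of_fixed D hE hram hπ hp N hy
    rw [mk_eq_of_isAlmostSelfDual hπ hnorm hval hφ hc hΛ hN]
  · rintro y ⟨N, rfl, r, hr, hN⟩ hy
    obtain ⟨c, hc, rfl⟩ := eq_maxVNorm_of_fixed D hE hram hπ hp N hy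
    exact mk_eq_of_dualNorm hπ hnorm hφ hc hr hN
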